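/- **Setting.** A symmetric congestion game has a finite set $E$ of resources, $n$ players, a common set $\mathcal P$ of strategies $P\subseteq E$, and non-decreasing differentiable latency functions $\ell_e:\mathbb R_{\ge0}\to\mathbb R_{\ge0}$ with $\ell_e(x)>0$ for $x>0$. (In a symmetric network congestion game, $E$ is the edge set of a directed network and $\mathcal P$ is the set of paths from a source to a sink.) In a state $x=(x_P)_{P\in\mathcal P}$, $x_P$ players use $P$; put $x_e=\sum_{P\ni e}x_P$, $\ell_P(x)=\sum_{e\in P}\ell_e(x_e)$, $\Phi(x)=\sum_{e\in E}\sum_{i=1}^{x_e}\ell_e(i)$, and $\ell_{\max}=\max_x\max_{P}\ell_P(x)$. Let $d\ge 1$ be an upper bound on the elasticities, $d\ge \ell_e'(y)\,y/\ell_e(y)$ for all $e\in E$ and $y\in(0,n]$; let $\nu_e=\max\{\ell_e(u)-\ell_e(u-1): u\in\mathbb N,\ 1\le u\le d\}$, and let $\nu\ge\max_{P\in\mathcal P}\sum_{e\in P}\nu_e$. **Imitation Protocol** (with parameter $\lambda>0$). In every round all players, in parallel and independently, do the following. A player on $P$ samples another player uniformly at random; let $Q$ be the strategy of that player. If $\ell_P(x)>\ell_Q(x+1_Q-1_P)+\nu$,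 the player migrates to $Q$ with probability $\frac{\lambda}{d}\cdot\frac{\ell_P(x)-\ell_Q(x+1_Q-1_P)}{\ell_P(x)}$; otherwise it stays. (If $n=1$ the player stays.) This generates a random sequence of states $x(0),x(1),\dots$. A state $x$ is *imitation-stable* if $x(t)=x$ implies $x(t+1)=x$ with probability $1$. **Theorem.** There is an absolute constant $\lambda_0>0$ such that for every $\lambda\in(0,\lambda_0]$ there is a constant $C$, depending only on $\lambda$, with the following properties. 1. For every symmetric congestion game, all $d\ge1$ and $\nu>0$ as above, and every initial state $x$, if all players use the Imitation Protocol, then the dynamics almost surely reach an imitation-stable state and stay in it forever, and the expected number of rounds until an imitation-stable state is first reached is at most $$C\cdot\frac{d\,n\,\ell_{\max}\,\Phi(x)}{\nu^2}.$$ 2. Suppose moreover that every $\ell_e$ is a polynomial of degree at most $d\in\mathbb N$ all of whose non-zero coefficients lie in $[a_{\min},a_{\max}]$, where $a_{\min}>0$, that some resource contained in a strategy has a non-constant latency function, and let $k=\max_{P\in\mathcal P}|P|$. If the players use the Imitation Protocol with this $d$ and with any $\nu\ge\max_{P}\sum_{e\in P}\nu_e$, then from every initial state the dynamics converge in the same sense,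 and the expected number of rounds until an imitation-stable state is first reached is at most $$C\cdot d^2\,k^2\,n^{2d+2}\left(\frac{a_{\max}}{a_{\min}}\right)^2 .$$ -/

import Mathlib

open MeasureTheory ProbabilityTheory
open scoped ENNReal

noncomputable section

/-- A symmetric congestion game over the finite set `E` of resources: `numPlayers` players share the
strategy set `strategies`, each strategy being a set of resources. The values of `latency e` at
negative arguments are irrelevant. -/
structure SymmetricCongestionGame (E : Type*) where
  numPlayers : ℕ
  strategies : Finset (Finset E)
  latency : E → ℝ → ℝ
  latency_nonneg : ∀ e x, 0 ≤ x → 0 ≤ latency e x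
  latency_pos : ∀ e x, 0 < x → 0 < latency e x
  latency_mono : ∀ e, MonotoneOn (latency e) (Set.Ici 0)
  latency_diff : ∀ e, DifferentiableOn ℝ (latency e) (Set.Ici 0)

/-- A directed multigraph with vertex set `V`, edge set `E`, a source and a sink. -/
structure DirectedNetwork (V E : Type*) where
  tail : E → V
  head : E → V
  source : V
  sink : V

namespace DirectedNetwork

variable {V E : Type*} (N : DirectedNetwork V E)

/-- `N.IsWalk u l v`: the edges of the list `l`, in this order, form a walk from `u` to `v`. -/
def IsWalk : V → List E → V → Prop
  | u, [], v => u = v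
  | u, e :: l, v => N.tail e = u ∧ IsWalk (N.head e) l v

/-- The edge sets of the simple directed paths from the source to the sink. -/
def paths [Fintype E] : Finset (Finset E) :=
  open Classical in
  {P | ∃ l : List E, N.IsWalk N.source l N.sink ∧ (N.source :: l.map N.head).Nodup ∧
    l.toFinset = P}

/-- The symmetric network congestion game: the strategies of all players are the paths from the
source to the sink. -/
def congestionGame [Fintype E] (n : ℕ) (latency : E → ℝ → ℝ)
    (h_nonneg : ∀ e x, 0 ≤ x → 0 ≤ latency e x) (h_pos : ∀ e x, 0 < x → 0 < latency e x)
    (h_mono : ∀ e, MonotoneOn (latency e) (Set.Ici 0))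
    (h_diff : ∀ e, DifferentiableOn ℝ (latency e) (Set.Ici 0)) : SymmetricCongestionGame E where
  numPlayers := n
  strategies := N.paths
  latency := latency
  latency_nonneg := h_nonneg
  latency_pos := h_pos
  latency_mono := h_mono
  latency_diff := h_diff

end DirectedNetwork

namespace SymmetricCongestionGame

variable {E : Type*} (G : SymmetricCongestionGame E)

/-- The type of strategies, a finite discrete space. -/
def Strategy : Type _ := {P : Finset E // P ∈ G.strategies}

instance : Fintype G.Strategy := inferInstanceAs (Fintype {P : Finset E // P ∈ G.strategies})

instance : MeasurableSpace G.Strategy := ⊤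

instance : DiscreteMeasurableSpace G.Strategy := ⟨fun _ => trivial⟩

/-- An assignment of a strategy to every player. -/
abbrev Profile : Type _ := Fin G.numPlayers → G.Strategy

variable {G}

open Classical in
/-- The state of a profile: the vector of the numbers `x_P` of players that use `P`. -/
def state (s : G.Profile) (P : G.Strategy) : ℕ := Finset.card {i | s i = P}

open Classical in
/-- The congestion `x_e`: the sum of `x_P` over the strategies `P` that contain `e`. -/
def congestion (s : G.Profile) (e : E) : ℕ := ∑ P : G.Strategy with e ∈ P.1, state s P

/-- The latency `ℓ_P(x)` of a strategy. -/
def strategyLatency (s : G.Profile) (P : G.Strategy) : ℝ :=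
  ∑ e ∈ P.1, G.latency e (congestion s e)

/-- The latency `ℓ_Q(x + 1_Q - 1_P)` of `Q` after player `i` alone has moved from its strategy `P`
to `Q`. -/
def latencyAfterMove (s : G.Profile) (i : Fin G.numPlayers) (Q : G.Strategy) : ℝ :=
  strategyLatency (Function.update s i Q) Q

/-- The potential `Φ(x) = ∑_e ∑_{u = 1}^{x_e} ℓ_e(u)`. -/
def potential [Fintype E] (s : G.Profile) : ℝ :=
  ∑ e : E, ∑ u ∈ Finset.Icc 1 (congestion s e), G.latency e u

variable (G)

/-- The maximum latency `ℓ_max` of a strategy, over all states and strategies. -/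
def maxLatency : ℝ := ⨆ p : G.Profile × G.Strategy, strategyLatency p.1 p.2

/-- `d` is an upper bound on the elasticity of the latency functions on `(0, n]`. -/
def IsElasticityBound (d : ℝ) : Prop :=
  ∀ e : E, ∀ x ∈ Set.Ioc (0 : ℝ) G.numPlayers, deriv (G.latency e) x * x / G.latency e x ≤ d

/-- The slope `ν_e` on an almost empty resource: the maximum of `ℓ_e(u) - ℓ_e(u - 1)` over the
integers `u` with `1 ≤ u ≤ d`. -/
def slope (d : ℝ) (e : E) : ℝ :=
  sSup ((fun u : ℕ => G.latency e u - G.latency e (u - 1)) '' Set.Icc 1 ⌊d⌋₊)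

/-- `ν` is at least the slope `ν_P = ∑_{e ∈ P} ν_e` of every strategy `P`. -/
def IsSlopeBound (d ν : ℝ) : Prop :=
  ∀ P ∈ G.strategies, ∑ e ∈ P, G.slope d e ≤ ν

variable {G}

open Classical in
/-- The law of the next strategy of player `i`, who uses `P = s i` and has sampled a player that
uses `Q`: if `ℓ_P(x) > ℓ_Q(x + 1_Q - 1_P) + ν`, then player `i` migrates to `Q` with probability
`(lam / d) * (ℓ_P(x) - ℓ_Q(x + 1_Q - 1_P)) / ℓ_P(x)`, and otherwise it stays. The projection to the
unit interval has no effect if `0 ≤ lam ≤ d`. -/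
def migrationLaw (lam d ν : ℝ) (s : G.Profile) (i : Fin G.numPlayers) (Q : G.Strategy) :
    Measure G.Strategy :=
  if strategyLatency s (s i) > latencyAfterMove s i Q + ν then
    bernoulliMeasure Q (s i) (Set.projIcc (0 : ℝ) 1 zero_le_one
      (lam / d * ((strategyLatency s (s i) - latencyAfterMove s i Q) / strategyLatency s (s i))))
  else Measure.dirac (s i)

/-- The law of the next strategy of player `i`: it samples another player uniformly at random and
then decides on the migration. A single player has nobody to sample and stays. -/
def playerLaw (lam d ν : ℝ) (s : G.Profile) (i : Fin G.numPlayers) : Measure G.Strategy :=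
  if h : (Finset.univ.erase i).Nonempty then
    (PMF.uniformOfFinset (Finset.univ.erase i) h).toMeasure.bind
      (fun j => migrationLaw lam d ν s i (s j))
  else Measure.dirac (s i)

instance (lam d ν : ℝ) (s : G.Profile) (i : Fin G.numPlayers) (Q : G.Strategy) :
    IsProbabilityMeasure (migrationLaw lam d ν s i Q) := by
  unfold migrationLaw
  split_ifs <;> infer_instance

instance (lam d ν : ℝ) (s : G.Profile) (i : Fin G.numPlayers) :
    IsProbabilityMeasure (playerLaw lam d ν s i) := by
  unfold playerLaw
  split_ifs with h
  · exact isProbabilityMeasure_bind (measurable_of_countable _).aemeasurable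
      (Filter.Eventually.of_forall fun j => inferInstance)
  · infer_instance

variable (G)

/-- One round of the imitation protocol: all players act independently and in parallel. -/
def roundKernel (lam d ν : ℝ) : Kernel G.Profile G.Profile :=
  Kernel.ofFunOfCountable fun s => Measure.pi fun i => playerLaw lam d ν s i

instance (lam d ν : ℝ) : IsMarkovKernel (G.roundKernel lam d ν) :=
  ⟨fun s => inferInstanceAs (IsProbabilityMeasure (Measure.pi fun i => playerLaw lam d ν s i))⟩

variable {G}

/-- The law of the sequence of profiles generated by the imitation protocol from the profile `s`:
the Markov chain with transition kernel `roundKernel`. -/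
def imitationDynamics (lam d ν : ℝ) (s : G.Profile) : Measure (ℕ → G.Profile) :=
  Kernel.trajMeasure (X := fun _ => G.Profile) (Measure.dirac s)
    (fun t => (G.roundKernel lam d ν).comap (fun w => w ⟨t, Finset.mem_Iic.2 le_rfl⟩)
      (measurable_pi_apply _))

/-- A state is imitation-stable if with probability one it does not change in the next round. -/
def IsImitationStable (lam d ν : ℝ) (s : G.Profile) : Prop :=
  ∀ᵐ s' ∂(G.roundKernel lam d ν s), state s' = state s

/-- The first round in which the state is imitation-stable (`⊤` if there is none). -/
def stableTime (lam d ν : ℝ) (w : ℕ → G.Profile) : ℝ≥0∞ :=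
  ⨅ (t : ℕ) (_ : IsImitationStable lam d ν (w t)), (t : ℝ≥0∞)

/-- The imitation dynamics from `s` almost surely reach an imitation-stable state and stay there
forever, and the expected time to reach it is at most `T`. -/
def ConvergesInExpectedTime (lam d ν : ℝ) (s : G.Profile) (T : ℝ) : Prop :=
  (∀ᵐ w ∂(imitationDynamics lam d ν s), ∃ t₀, IsImitationStable lam d ν (w t₀) ∧
    ∀ t ≥ t₀, state (w t) = state (w t₀)) ∧
  ∫⁻ w, stableTime lam d ν w ∂(imitationDynamics lam d ν s) ≤ ENNReal.ofReal T

end SymmetricCongestionGame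

end

/-! The proof is a drift argument for Rosenthal's potential `Φ`. If the players moved one at a time,
`Φ` would drop by exactly the improvement of each mover; the expectation of these improvements in
one round is `virtualGain`. Simultaneous moves spoil this. On a resource with congestion `x`, `A`
arrivals and `D` departures, the change of `Φ` is at most `A ℓ(x+1) - D ℓ(x)`, which accounts for
the virtual gain, plus the excesses `∑_{u<A} (ℓ(x+1+u) - ℓ(x+1))` and `∑_{u<D} (ℓ(x) - ℓ(x-u))`.

The excesses are of second order. Bounded elasticity makes latencies grow at exponential rate about
`β = d/x` per extra player, and for a sum of independent indicators with mean `M` the expected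
excess is then of order `β M² ℓ` (`integral_sum_exp_sub_one_le`). A migration probability is `λ/d`
times the relative gain of the mover, so its square is `λ/d` times the probability weighted by that
gain. With Cauchy–Schwarz and the fact that only `(n-x)x` pairs of players can cause an arrival, `M²
≤ (λ/d) x g`, where `g` is the gain-weighted mean (`expectedMoves_sq_le`). Hence `β M² ≤ λ g` up to
constants. On resources with `x < ⌊d⌋` the rate `d/x` is too large; there the slope `ν_e` controls
the increments and costs a further term `λ M ν_e`.

Summed over resources and regrouped by pairs of players, the excess of a pair is at most `20λ` times
its contribution to the virtual gain: relative gain times latency is at most the improvement, and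
the slopes along a strategy add up to at most `ν`, which is less than the improvement of any
migrating player. So for `λ ≤ 1/40` the expected potential drops by half the virtual gain
(`integral_potential_le`). In an unstable state one pair alone gives a virtual gain of at least
`λν²/(d n ℓ_max)` (`le_virtualGain`), and the drift bound on hitting times
(`lintegral_hittingTime_le`) finishes part 1. Part 2 inserts `Φ ≤ n ℓ_max`, `ℓ_max ≤ 2 k a_max n^d`
and `ν ≥ a_min`. -/

/-! ### Markov chains: absorption and expected hitting times. -/

section MarkovChain

variable {X : Type*} [MeasurableSpace X]

/-- The law of the Markov chain with transition kernel `K` started at `x`. -/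
noncomputable def markovChainLaw (K : Kernel X X) [IsMarkovKernel K] (x : X) : Measure (ℕ → X) :=
  Kernel.trajMeasure (X := fun _ => X) (Measure.dirac x)
    (fun t => K.comap (fun w => w ⟨t, Finset.mem_Iic.2 le_rfl⟩) (measurable_pi_apply _))

variable (K : Kernel X X) [IsMarkovKernel K] (x : X)

instance : IsProbabilityMeasure (markovChainLaw K x) := by
  unfold markovChainLaw; infer_instance

/-- The Markov property in integrated form: a function of the past is kept fixed while the next
state is averaged out. -/
theorem lintegral_markovChainLaw_succ (t : ℕ) {g : (Finset.Iic t → X) → ℝ≥0∞} (hg : Measurable g)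
    {f : X → ℝ≥0∞} (hf : Measurable f) :
    ∫⁻ w, g (Preorder.frestrictLe t w) * f (w (t + 1)) ∂(markovChainLaw K x) =
      ∫⁻ w, g (Preorder.frestrictLe t w) * ∫⁻ y, f y ∂(K (w t)) ∂(markovChainLaw K x) := by
  have key := Kernel.map_frestrictLe_trajMeasure_compProd_eq_map_trajMeasure
    (X := fun _ => X) (μ₀ := Measure.dirac x)
    (κ := fun t => K.comap (fun w => w ⟨t, Finset.mem_Iic.2 le_rfl⟩) (measurable_pi_apply _))
    (a := t)
  change (markovChainLaw K x).map _ ⊗ₘ _ = (markovChainLaw K x).map _ at key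
  have hm : Measurable fun p : (Finset.Iic t → X) × X => g p.1 * f p.2 :=
    (hg.comp measurable_fst).mul (hf.comp measurable_snd)
  have h1 := lintegral_map (μ := markovChainLaw K x)
    (f := fun p : (Finset.Iic t → X) × X => g p.1 * f p.2)
    (g := fun w => (Preorder.frestrictLe (π := fun _ => X) t w, w (t + 1))) hm (by fun_prop)
  refine h1.symm.trans ?_
  rw [← key, Measure.lintegral_compProd hm, lintegral_map hm.lintegral_kernel_prod_right'
    (by fun_prop)]
  refine lintegral_congr fun w => ?_
  exact lintegral_const_mul (μ := K (w t)) (g (Preorder.frestrictLe t w)) hf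

theorem ae_markovChainLaw_zero [MeasurableSingletonClass X] :
    ∀ᵐ w ∂(markovChainLaw K x), w 0 = x := by
  have hmap : (markovChainLaw K x).map (Preorder.frestrictLe 0) =
      (Measure.dirac x).map (MeasurableEquiv.piUnique (fun _ : Finset.Iic 0 => X)).symm := by
    unfold markovChainLaw Kernel.trajMeasure
    rw [Measure.map_comp _ _ (by fun_prop), Kernel.traj_map_frestrictLe, Kernel.partialTraj_self]
    exact Measure.id_comp
  have hev : Measurable fun v : Finset.Iic 0 → X => v ⟨0, Finset.mem_Iic.2 le_rfl⟩ :=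
    measurable_pi_apply _
  have h2 : (markovChainLaw K x).map (fun w => w 0) = Measure.dirac x := by
    have h3 : (fun w : ℕ → X => w 0) = (fun v : Finset.Iic 0 → X => v ⟨0, Finset.mem_Iic.2 le_rfl⟩)
        ∘ Preorder.frestrictLe (π := fun _ => X) 0 := rfl
    rw [h3, ← Measure.map_map hev (by fun_prop), hmap, Measure.map_map hev (by fun_prop),
      Measure.map_dirac' (by fun_prop)]
    rfl
  have h4 : ∀ᵐ y ∂((markovChainLaw K x).map (fun w => w 0)), y = x := by
    rw [h2]; simp [ae_dirac_eq]
  exact ae_of_ae_map (measurable_pi_apply 0).aemeasurable h4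

variable [DiscreteMeasurableSpace X]

/-- The chain does not leave a set of absorbing points. -/
theorem ae_markovChainLaw_absorbed [Countable X] {S : Set X} (hS : ∀ y ∈ S, K y = Measure.dirac y) :
    ∀ᵐ w ∂(markovChainLaw K x), ∀ t₀, w t₀ ∈ S → ∀ t ≥ t₀, w t = w t₀ := by
  classical
  have step : ∀ t, ∀ᵐ w ∂(markovChainLaw K x), w t ∈ S → w (t + 1) = w t := by
    intro t
    -- By countability each absorbing point `y` can be treated separately; the Markov property is
    -- tested on the indicators of `{y}` and its complement.
    have hcount : ∀ᵐ w ∂(markovChainLaw K x), ∀ y ∈ S, ¬ (w t = y ∧ w (t + 1) ≠ y) := by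
      rw [ae_all_iff]
      intro y
      by_cases hy : y ∈ S
      swap
      · exact Filter.Eventually.of_forall fun w h => (hy h).elim
      have h := lintegral_markovChainLaw_succ K x t
        (g := fun v => ({y} : Set X).indicator 1 (v ⟨t, Finset.mem_Iic.2 le_rfl⟩))
        (f := ({y}ᶜ : Set X).indicator 1)
        (measurable_of_countable _) (measurable_of_countable _)
      have h0 : ∫⁻ w, ({y} : Set X).indicator (1 : X → ℝ≥0∞) (w t) *
          ∫⁻ z, ({y}ᶜ : Set X).indicator 1 z ∂(K (w t)) ∂(markovChainLaw K x) = 0 := by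
        rw [lintegral_eq_zero_iff (by
          exact (measurable_of_countable (fun z => ({y} : Set X).indicator (1 : X → ℝ≥0∞) z *
            ∫⁻ z, ({y}ᶜ : Set X).indicator 1 z ∂(K z))).comp (measurable_pi_apply t))]
        refine Filter.Eventually.of_forall fun w => ?_
        by_cases hw : w t = y
        · simp [hw, hS y hy]
        · simp [hw]
      have h1 := h.trans h0
      rw [lintegral_eq_zero_iff (by
        exact ((measurable_of_countable (({y} : Set X).indicator (1 : X → ℝ≥0∞))).comp
          (measurable_pi_apply t)).mul ((measurable_of_countable
          (({y}ᶜ : Set X).indicator (1 : X → ℝ≥0∞))).comp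
          (measurable_pi_apply (t + 1))))] at h1
      filter_upwards [h1] with w hw _ hc
      have h1' : w t = y := hc.1
      simp [Preorder.frestrictLe, h1', hc.2] at hw
    filter_upwards [hcount] with w hw hS
    by_contra hne
    exact hw _ hS ⟨rfl, hne⟩
  filter_upwards [ae_all_iff.2 step] with w hw t₀ h0 t ht
  induction t, ht using Nat.le_induction with
  | base => rfl
  | succ t _ ih => rw [hw t (ih ▸ h0), ih]

/-- A drift condition outside of `S` bounds the expected hitting time of `S`. -/
theorem lintegral_hittingTime_le [Countable X] {S : Set X} {V : X → ℝ≥0∞} {c : ℝ≥0∞}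
    (hc : c ≠ 0) (hc' : c ≠ ∞)
    (hV : ∀ y ∉ S, ∫⁻ z, V z ∂(K y) + c ≤ V y) :
    ∫⁻ w, (⨅ (t : ℕ) (_ : w t ∈ S), (t : ℝ≥0∞)) ∂(markovChainLaw K x) ≤ V x / c := by
  classical
  set P := markovChainLaw K x
  -- `u t` indicates that `S` has not been hit before time `t`. Thus `u (t + 1)` depends on the path
  -- up to time `t` only, and the sum of all `u (t + 1)` dominates the hitting time.
  let u : ℕ → (ℕ → X) → ℝ≥0∞ := fun t w => if ∀ k < t, w k ∉ S then 1 else 0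
  have humeas : ∀ t, Measurable (u t) := by
    intro t
    refine Measurable.ite ?_ measurable_const measurable_const
    have : {w : ℕ → X | ∀ k < t, w k ∉ S} = ⋂ k, ⋂ (_ : k < t), (fun w : ℕ → X => w k) ⁻¹' Sᶜ := by
      ext w; simp
    rw [this]
    exact MeasurableSet.iInter fun k => MeasurableSet.iInter fun _ =>
      measurable_pi_apply k (MeasurableSet.of_discrete)
  have hVm : Measurable V := measurable_of_countable _
  have hstep : ∀ t, (∫⁻ w, u (t + 1) w * V (w (t + 1)) ∂P) + c * ∫⁻ w, u (t + 1) w ∂P ≤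
      ∫⁻ w, u t w * V (w t) ∂P := by
    intro t
    let g : (Finset.Iic t → X) → ℝ≥0∞ := fun v => if ∀ k, v k ∉ S then 1 else 0
    have hgu : ∀ w : ℕ → X, g (Preorder.frestrictLe t w) = u (t + 1) w := by
      intro w
      have : (∀ k : Finset.Iic t, w k ∉ S) ↔ ∀ k < t + 1, w k ∉ S :=
        ⟨fun h k hk => h ⟨k, Finset.mem_Iic.2 (by omega)⟩,
          fun h k => h k (by have := Finset.mem_Iic.1 k.2; omega)⟩
      exact if_congr this rfl rfl
    have h := lintegral_markovChainLaw_succ K x t (g := g) (measurable_of_countable _) hVm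
    simp only [hgu] at h
    rw [h, ← lintegral_const_mul _ (humeas _), ← lintegral_add_right _ ((humeas _).const_mul c)]
    refine lintegral_mono fun w => ?_
    by_cases hw : ∀ k < t + 1, w k ∉ S
    · have hw' : ∀ k < t, w k ∉ S := fun k hk => hw k (by omega)
      simp only [u, if_pos hw, if_pos hw', one_mul, mul_one]
      exact hV _ (hw t (by omega))
    · simp [u, if_neg hw]
  have hsum : ∀ N, (∫⁻ w, u N w * V (w N) ∂P) + c * ∑ t ∈ Finset.range N, ∫⁻ w, u (t + 1) w ∂P
      ≤ V x := by
    intro N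
    induction N with
    | zero =>
      have : ∫⁻ w, u 0 w * V (w 0) ∂P = ∫⁻ _, V x ∂P :=
        lintegral_congr_ae (by
          filter_upwards [ae_markovChainLaw_zero K x] with w hw
          simp [u, hw])
      simp [this, P]
    | succ N ih =>
      refine le_trans ?_ ih
      rw [Finset.sum_range_succ, mul_add, add_comm (c * _), ← add_assoc]
      exact add_le_add_left (hstep N) _
  have hle : ∀ w : ℕ → X, (⨅ (t : ℕ) (_ : w t ∈ S), (t : ℝ≥0∞)) ≤ ∑' t, u (t + 1) w := by
    intro w
    by_cases hw : ∃ t, w t ∈ S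
    · have hmin : ∀ k < Nat.find hw, w k ∉ S := fun k hk => Nat.find_min hw hk
      refine (iInf₂_le (Nat.find hw) (Nat.find_spec hw)).trans ?_
      refine le_trans ?_ (ENNReal.sum_le_tsum (Finset.range (Nat.find hw)))
      rw [Finset.sum_congr rfl (g := fun _ => 1)]
      · simp
      · intro t ht
        have ht := Finset.mem_range.1 ht
        exact if_pos fun k hk => hmin k (by omega)
    · push Not at hw
      have : ∀ t, u (t + 1) w = 1 := fun t => if_pos fun k _ => hw k
      simp [this]
  calc ∫⁻ w, (⨅ (t : ℕ) (_ : w t ∈ S), (t : ℝ≥0∞)) ∂P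
      ≤ ∫⁻ w, ∑' t, u (t + 1) w ∂P := lintegral_mono hle
    _ = ∑' t, ∫⁻ w, u (t + 1) w ∂P := lintegral_tsum fun t => (humeas _).aemeasurable
    _ ≤ V x / c := by
      rw [ENNReal.tsum_eq_iSup_nat]
      refine iSup_le fun N => ?_
      rw [ENNReal.le_div_iff_mul_le (Or.inl hc) (Or.inl hc'), mul_comm]
      exact le_add_self.trans (hsum N)

end MarkovChain

/-! ### Exponential moments of sums of independent indicators. -/

section IndependentCounts

variable {ι α : Type*} [Fintype ι] [Finite α] [MeasurableSpace α] [DiscreteMeasurableSpace α]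

theorem integrable_of_discrete {Ω : Type*} [Finite Ω] [MeasurableSpace Ω]
    [DiscreteMeasurableSpace Ω] (μ : Measure Ω) [IsFiniteMeasure μ] (f : Ω → ℝ) :
    Integrable f μ :=
  Integrable.of_finite

variable (μ : ι → Measure α) [∀ i, IsProbabilityMeasure (μ i)] (B : ι → Set α)

open Classical in
/-- The number of coordinates `i` of `w` in `B i`. -/
noncomputable def hitCount (w : ι → α) : ℕ := Finset.card {i | w i ∈ B i}

theorem integral_hitCount :
    ∫ w, (hitCount B w : ℝ) ∂(Measure.pi μ) = ∑ i, (μ i).real (B i) := by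
  classical
  have h : ∀ w : ι → α, (hitCount B w : ℝ) = ∑ i, (B i).indicator 1 (w i) := by
    intro w
    simp [hitCount, Set.indicator_apply, Finset.sum_boole]
  simp_rw [h]
  rw [integral_finsetSum _ fun i _ => integrable_of_discrete _ _]
  refine Finset.sum_congr rfl fun i _ => ?_
  rw [← integral_indicator_one (MeasurableSet.of_discrete), ← (measurePreserving_eval μ i).map_eq,
    integral_map (measurable_pi_apply i).aemeasurable
      (measurable_of_finite _).aestronglyMeasurable]

/-- By independence the expectation is the product of the factors `1 + p_i (e^β - 1)`, each at most
`exp (p_i (e^β - 1))`. -/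
theorem integral_exp_mul_hitCount_le (β : ℝ) :
    ∫ w, Real.exp (β * hitCount B w) ∂(Measure.pi μ) ≤
      Real.exp ((∑ i, (μ i).real (B i)) * (Real.exp β - 1)) := by
  classical
  have h : ∀ w : ι → α, Real.exp (β * hitCount B w) =
      ∏ i, (1 + (Real.exp β - 1) * (B i).indicator 1 (w i)) := by
    intro w
    rw [mul_comm, Real.exp_nat_mul, hitCount, ← Finset.prod_const, Finset.prod_filter]
    refine Finset.prod_congr rfl fun i _ => ?_
    by_cases hi : w i ∈ B i <;> simp [hi]
  simp_rw [h]
  rw [integral_fintype_prod_eq_prod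
    (f := fun i a => 1 + (Real.exp β - 1) * (B i).indicator 1 a), Finset.sum_mul, Real.exp_sum]
  have hint : ∀ i, ∫ a, (1 + (Real.exp β - 1) * (B i).indicator 1 a) ∂(μ i) =
      1 + (μ i).real (B i) * (Real.exp β - 1) := by
    intro i
    rw [integral_add (integrable_of_discrete _ _) (integrable_of_discrete _ _),
      integral_const_mul, integral_indicator_one (MeasurableSet.of_discrete)]
    simp [mul_comm]
  simp_rw [hint]
  refine Finset.prod_le_prod (fun i _ => ?_) fun i _ => ?_
  · have h1 : (μ i).real (B i) ≤ 1 := measureReal_le_one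
    have h0 : 0 ≤ (μ i).real (B i) := measureReal_nonneg
    nlinarith [Real.exp_pos β]
  · rw [add_comm]; exact Real.add_one_le_exp _

/-- The chord of the exponential over `[0, 2]` has slope at most `(9 - 1) / 2`. -/
theorem exp_sub_one_le_four_mul {β : ℝ} (h0 : 0 ≤ β) (h2 : β ≤ 2) : Real.exp β - 1 ≤ 4 * β := by
  have h := convexOn_exp.2 (Set.mem_univ 0) (Set.mem_univ 2)
    (show 0 ≤ 1 - β / 2 by linarith) (show 0 ≤ β / 2 by linarith) (by ring)
  have he : Real.exp 2 ≤ 9 := by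
    have h1 := Real.exp_one_lt_d9
    have h3 : Real.exp 2 = Real.exp 1 * Real.exp 1 := by rw [← Real.exp_add]; norm_num
    nlinarith [Real.exp_pos 1]
  simp only [smul_eq_mul, mul_zero, zero_add, Real.exp_zero, mul_one] at h
  rw [div_mul_cancel₀ β two_ne_zero] at h
  nlinarith

/-- The second-order excess of an exponential of a sum of independent indicators. -/
theorem integral_sum_exp_sub_one_le {β M : ℝ} (hβ : 0 < β) (hβ2 : β ≤ 2)
    (hM : ∑ i, (μ i).real (B i) = M) (hMβ : M * β ≤ 1 / 4) :
    ∫ w, (∑ u ∈ Finset.range (hitCount B w), (Real.exp (β * u) - 1)) ∂(Measure.pi μ) ≤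
      4 * β * M ^ 2 := by
  have hM0 : 0 ≤ M := hM ▸ Finset.sum_nonneg fun i _ => measureReal_nonneg
  set r := Real.exp β - 1 with hr
  have hr0 : 0 < r := by have := Real.add_one_lt_exp hβ.ne'; linarith
  have hr4 : r ≤ 4 * β := exp_sub_one_le_four_mul hβ.le hβ2
  -- Summing the geometric series exposes a cancellation: the expectation of the right side is at
  -- most `r⁻¹ (exp (M r) - 1) - M`, whose first-order part vanishes, so that `r M²` remains.
  have hgeom : ∀ N : ℕ, ∑ u ∈ Finset.range N, (Real.exp (β * u) - 1) =
      r⁻¹ * (Real.exp (β * N) - 1) - N := by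
    intro N
    have h1 : ∀ u : ℕ, Real.exp (β * u) = Real.exp β ^ u := fun u => by
      rw [mul_comm, Real.exp_nat_mul]
    simp_rw [h1, Finset.sum_sub_distrib]
    rw [geom_sum_eq (by linarith : Real.exp β ≠ 1)]
    simp [hr, div_eq_inv_mul]
  simp_rw [hgeom]
  rw [integral_sub (integrable_of_discrete _ _) (integrable_of_discrete _ _), integral_const_mul,
    integral_sub (integrable_of_discrete _ _) (integrable_of_discrete _ _), integral_hitCount, hM]
  have hexp := integral_exp_mul_hitCount_le μ B β
  rw [hM, ← hr] at hexp
  have hz0 : 0 ≤ M * r := mul_nonneg hM0 hr0.le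
  have hz1 : M * r ≤ 1 := by nlinarith
  have hq := (abs_le.1 (Real.abs_exp_sub_one_sub_id_le (abs_le.2 ⟨by linarith, hz1⟩))).2
  simp only [integral_const, probReal_univ, smul_eq_mul, mul_one]
  calc r⁻¹ * (∫ w, Real.exp (β * hitCount B w) ∂(Measure.pi μ) - 1) - M
      ≤ r⁻¹ * (M * r + (M * r) ^ 2) - M := by
        gcongr
        linarith
    _ = r * M ^ 2 := by field_simp; ring
    _ ≤ 4 * β * M ^ 2 := by gcongr

end IndependentCounts

/-! ### Growth of functions of bounded elasticity. -/

section Elasticity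

variable {f : ℝ → ℝ} {n d : ℝ}

/-- A function of elasticity at most `d` grows at most like the power `d`. -/
theorem le_mul_rpow_of_elasticity_le (hpos : ∀ x, 0 < x → 0 < f x)
    (hdiff : DifferentiableOn ℝ f (Set.Ici 0))
    (hel : ∀ x ∈ Set.Ioc 0 n, deriv f x * x / f x ≤ d) {a b : ℝ} (ha : 0 < a) (hab : a ≤ b)
    (hbn : b ≤ n) : f b ≤ f a * (b / a) ^ d := by
  have hb : 0 < b := ha.trans_le hab
  have hd : ∀ x, 0 < x → DifferentiableAt ℝ f x := fun x hx =>
    (hdiff x hx.le).differentiableAt (Ici_mem_nhds hx)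
  have hder : ∀ x, 0 < x → HasDerivAt (fun y => Real.log (f y) - d * Real.log y)
      (deriv f x / f x - d * x⁻¹) x := fun x hx =>
    ((hd x hx).hasDerivAt.log (hpos x hx).ne').sub ((Real.hasDerivAt_log hx.ne').const_mul d)
  -- The elasticity bound says that `log f - d log` has non-positive derivative.
  have hanti : AntitoneOn (fun y => Real.log (f y) - d * Real.log y) (Set.Icc a b) := by
    refine antitoneOn_of_deriv_nonpos (convex_Icc a b)
      (fun x hx => (hder x (ha.trans_le hx.1)).continuousAt.continuousWithinAt)
      (fun x hx => ?_) (fun x hx => ?_)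
    · rw [interior_Icc] at hx
      exact (hder x (ha.trans hx.1)).differentiableAt.differentiableWithinAt
    · rw [interior_Icc] at hx
      have hx0 : 0 < x := ha.trans hx.1
      rw [(hder x hx0).deriv]
      have h := hel x ⟨hx0, hx.2.le.trans hbn⟩
      rw [div_le_iff₀ (hpos x hx0)] at h
      rw [sub_nonpos, div_le_iff₀ (hpos x hx0), mul_right_comm, ← div_eq_mul_inv, le_div_iff₀ hx0]
      exact h
  have h := hanti (Set.left_mem_Icc.2 hab) (Set.right_mem_Icc.2 hab) hab
  simp only at h
  have hfa := hpos a ha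
  have hfb := hpos b hb
  have hba : 0 < b / a := div_pos hb ha
  rw [← Real.log_le_log_iff hfb (mul_pos hfa (Real.rpow_pos_of_pos hba d)),
    Real.log_mul hfa.ne' (Real.rpow_pos_of_pos hba d).ne', Real.log_rpow hba,
    Real.log_div hb.ne' ha.ne']
  linarith

theorem le_mul_exp_of_elasticity_le (hd : 0 ≤ d) (hpos : ∀ x, 0 < x → 0 < f x)
    (hdiff : DifferentiableOn ℝ f (Set.Ici 0))
    (hel : ∀ x ∈ Set.Ioc 0 n, deriv f x * x / f x ≤ d) {a b : ℝ} (ha : 0 < a) (hab : a ≤ b)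
    (hbn : b ≤ n) : f b ≤ f a * Real.exp (d / a * (b - a)) := by
  refine (le_mul_rpow_of_elasticity_le hpos hdiff hel ha hab hbn).trans ?_
  refine mul_le_mul_of_nonneg_left ?_ (hpos a ha).le
  have hb : 0 ≤ b / a := (div_pos (ha.trans_le hab) ha).le
  have h1 : b / a ≤ Real.exp ((b - a) / a) := by
    have := Real.add_one_le_exp ((b - a) / a)
    have h2 : (b - a) / a + 1 = b / a := by field_simp; ring
    linarith
  calc (b / a) ^ d ≤ Real.exp ((b - a) / a) ^ d := Real.rpow_le_rpow hb h1 hd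
    _ = Real.exp (d / a * (b - a)) := by rw [← Real.exp_mul]; congr 1; ring

/-- Bernoulli's inequality `(a/b)^d ≥ 1 + d (a/b - 1)`, which needs `d ≥ 1`, turns power growth into
a linear bound relative to the larger value `f b`. -/
theorem sub_le_of_elasticity_le (hd : 1 ≤ d) (hpos : ∀ x, 0 < x → 0 < f x)
    (hdiff : DifferentiableOn ℝ f (Set.Ici 0))
    (hel : ∀ x ∈ Set.Ioc 0 n, deriv f x * x / f x ≤ d) {a b : ℝ} (ha : 0 < a) (hab : a ≤ b)
    (hbn : b ≤ n) : f b - f a ≤ d / b * (b - a) * f b := by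
  have hb : 0 < b := ha.trans_le hab
  have h := le_mul_rpow_of_elasticity_le hpos hdiff hel ha hab hbn
  have h1 : f b * (a / b) ^ d ≤ f a := by
    calc f b * (a / b) ^ d ≤ f a * (b / a) ^ d * (a / b) ^ d :=
          mul_le_mul_of_nonneg_right h (Real.rpow_nonneg (by positivity) d)
      _ = f a := by
          rw [mul_assoc, ← Real.mul_rpow (by positivity) (by positivity)]
          field_simp
          simp
  have h2 := one_add_mul_self_le_rpow_one_add (s := a / b - 1)
    (by have : 0 < a / b := by positivity
        linarith) hd
  rw [add_sub_cancel] at h2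
  have h3 : f b * (1 + d * (a / b - 1)) ≤ f a :=
    (mul_le_mul_of_nonneg_left h2 (hpos b hb).le).trans h1
  have h4 : d / b * (b - a) * f b = f b - f b * (1 + d * (a / b - 1)) := by field_simp; ring
  linarith

/-- Increments on an almost empty resource, where only the slope is under control up to `d`. -/
theorem sub_le_of_slope_le (hd : 1 ≤ d) (hpos : ∀ x, 0 < x → 0 < f x)
    (hdiff : DifferentiableOn ℝ f (Set.Ici 0))
    (hel : ∀ x ∈ Set.Ioc 0 n, deriv f x * x / f x ≤ d) {σ : ℝ}
    (hσ0 : 0 ≤ σ)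
    (hσ : ∀ u : ℕ, 1 ≤ u → u ≤ ⌊d⌋₊ → f u - f (u - 1) ≤ σ) {x j : ℕ} (hx : x + 1 ≤ ⌊d⌋₊)
    (hn : ((x + 1 + j : ℕ) : ℝ) ≤ n) :
    f ((x + 1 + j : ℕ) : ℝ) - f ((x + 1 : ℕ) : ℝ) ≤
      (f ((x + 1 : ℕ) : ℝ) + σ) * (Real.exp (2 * j) - 1) := by
  have hslope : ∀ j : ℕ, x + 1 + j ≤ ⌊d⌋₊ →
      f ((x + 1 + j : ℕ) : ℝ) - f ((x + 1 : ℕ) : ℝ) ≤ j * σ := by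
    intro j hj
    induction j with
    | zero => simp
    | succ j ih =>
      have h1 := ih (by omega)
      have h2 := hσ (x + 1 + j + 1) (by omega) (by omega)
      push_cast at h1 h2 ⊢
      rw [show (x : ℝ) + 1 + j + 1 - 1 = x + 1 + j by ring] at h2
      rw [show (x : ℝ) + 1 + (j + 1) = x + 1 + j + 1 by ring]
      linarith
  have hf := hpos ((x + 1 : ℕ) : ℝ) (by positivity)
  have hlin : ∀ j : ℕ, (j : ℝ) ≤ Real.exp (2 * j) - 1 := by
    intro j
    have h1 := Real.add_one_le_exp (2 * (j : ℝ))
    have h2 : (0 : ℝ) ≤ j := by positivity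
    linarith
  rcases le_total (x + 1 + j) ⌊d⌋₊ with hj | hj
  · have h1 := hslope j hj
    have h2 := mul_le_mul_of_nonneg_right (hlin j) hσ0
    have h3 : 0 ≤ Real.exp (2 * (j : ℝ)) - 1 := le_trans (by positivity) (hlin j)
    nlinarith
  -- The slope bound covers the `i` steps up to `⌊d⌋`. The remaining `r` steps use elasticity from
  -- `⌊d⌋` on, at rate `d / ⌊d⌋ ≤ 2`; this is the source of the `2` in the exponent.
  · obtain ⟨i, hi⟩ := Nat.exists_eq_add_of_le hx
    obtain ⟨r, hr⟩ := Nat.exists_eq_add_of_le hj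
    have hjr : j = i + r := by omega
    subst hjr
    have hD1 : (1 : ℝ) ≤ (⌊d⌋₊ : ℝ) := by exact_mod_cast (show 1 ≤ ⌊d⌋₊ by omega)
    have hDd : d ≤ 2 * (⌊d⌋₊ : ℝ) := by have := Nat.lt_floor_add_one d; linarith
    have hgrow := le_mul_exp_of_elasticity_le (by linarith) hpos hdiff hel
      (a := (⌊d⌋₊ : ℝ)) (b := ((x + 1 + (i + r) : ℕ) : ℝ)) (by linarith)
      (by exact_mod_cast hj) hn
    have hexp : Real.exp (d / ⌊d⌋₊ * (((x + 1 + (i + r) : ℕ) : ℝ) - ⌊d⌋₊)) ≤ Real.exp (2 * r) := by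
      refine Real.exp_le_exp.2 ?_
      have : ((x + 1 + (i + r) : ℕ) : ℝ) - ⌊d⌋₊ = r := by rw [hr]; push_cast; ring
      rw [this]
      refine mul_le_mul_of_nonneg_right ?_ (by positivity)
      rw [div_le_iff₀ (by linarith)]
      exact hDd
    have hD := hslope i hi.ge
    rw [← hi] at hD
    have hDpos := hpos (⌊d⌋₊ : ℝ) (by linarith)
    have h1 : f ((x + 1 + (i + r) : ℕ) : ℝ) ≤
        (f ((x + 1 : ℕ) : ℝ) + i * σ) * Real.exp (2 * r) := by
      refine hgrow.trans ((mul_le_mul_of_nonneg_left hexp hDpos.le).trans ?_)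
      exact mul_le_mul_of_nonneg_right (by linarith) (Real.exp_pos _).le
    have hsplit : Real.exp (2 * ((i + r : ℕ) : ℝ)) = Real.exp (2 * i) * Real.exp (2 * r) := by
      rw [← Real.exp_add]; congr 1; push_cast; ring
    have hi1 := hlin i
    have hr1 : 1 ≤ Real.exp (2 * (r : ℝ)) := Real.one_le_exp (by positivity)
    have hei : 1 ≤ Real.exp (2 * (i : ℝ)) := Real.one_le_exp (by positivity)
    rw [hsplit]
    have h2 : f ((x + 1 : ℕ) : ℝ) * Real.exp (2 * r) ≤
        f ((x + 1 : ℕ) : ℝ) * (Real.exp (2 * i) * Real.exp (2 * r)) :=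
      mul_le_mul_of_nonneg_left (by nlinarith) hf.le
    have h3 : i * σ * Real.exp (2 * r) ≤ σ * (Real.exp (2 * i) * Real.exp (2 * r) - 1) := by
      have : (i : ℝ) * Real.exp (2 * r) ≤ Real.exp (2 * i) * Real.exp (2 * r) - 1 := by
        nlinarith
      calc i * σ * Real.exp (2 * r) = σ * (i * Real.exp (2 * r)) := by ring
        _ ≤ _ := mul_le_mul_of_nonneg_left this hσ0
    nlinarith

end Elasticity

/-! ### Congestion, arrivals and departures. -/

namespace SymmetricCongestionGame

variable {E : Type*} {G : SymmetricCongestionGame E}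

open Classical in
theorem congestion_eq_sum (s : G.Profile) (e : E) :
    congestion s e = ∑ i, if e ∈ (s i).1 then 1 else 0 := by
  unfold congestion state
  rw [← Finset.card_filter, Finset.card_eq_sum_card_fiberwise (f := s)
    (t := {P : G.Strategy | e ∈ P.1}) (fun i hi => by simpa using hi)]
  refine Finset.sum_congr rfl fun P hP => ?_
  congr 1
  ext i
  simp only [Finset.mem_filter, Finset.mem_univ, true_and] at hP ⊢
  exact ⟨fun h => ⟨h ▸ hP, h⟩, fun h => h.2⟩

open Classical in
theorem congestion_eq_card (s : G.Profile) (e : E) :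
    congestion s e = Finset.card {i | e ∈ (s i).1} := by
  rw [congestion_eq_sum, Finset.card_filter]

theorem congestion_le (s : G.Profile) (e : E) : congestion s e ≤ G.numPlayers := by
  classical
  rw [congestion_eq_card]
  exact (Finset.card_le_univ _).trans_eq (Fintype.card_fin _)

open Classical in
theorem congestion_update_add (s : G.Profile) (i : Fin G.numPlayers) (Q : G.Strategy) (e : E) :
    congestion (Function.update s i Q) e + (if e ∈ (s i).1 then 1 else 0) =
      congestion s e + (if e ∈ Q.1 then 1 else 0) := by
  rw [congestion_eq_sum, congestion_eq_sum, ← Finset.add_sum_erase _ _ (Finset.mem_univ i),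
    ← Finset.add_sum_erase _ (fun k => if e ∈ (s k).1 then 1 else 0) (Finset.mem_univ i),
    Function.update_self]
  have : ∑ k ∈ Finset.univ.erase i, (if e ∈ (Function.update s i Q k).1 then 1 else 0) =
      ∑ k ∈ Finset.univ.erase i, (if e ∈ (s k).1 then 1 else 0) :=
    Finset.sum_congr rfl fun k hk => by
      rw [Function.update_of_ne (Finset.ne_of_mem_erase hk)]
  rw [this]
  omega

/-- The strategies by which player `i` newly arrives at the resource `e`. -/
def arrivals (s : G.Profile) (e : E) (i : Fin G.numPlayers) : Set G.Strategy :=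
  {Q | e ∉ (s i).1 ∧ e ∈ Q.1}

/-- The strategies by which player `i` departs from the resource `e`. -/
def departures (s : G.Profile) (e : E) (i : Fin G.numPlayers) : Set G.Strategy :=
  {Q | e ∈ (s i).1 ∧ e ∉ Q.1}

theorem mem_arrivals {s : G.Profile} {e : E} {i : Fin G.numPlayers} {Q : G.Strategy} :
    Q ∈ arrivals s e i ↔ e ∉ (s i).1 ∧ e ∈ Q.1 := Iff.rfl

theorem mem_departures {s : G.Profile} {e : E} {i : Fin G.numPlayers} {Q : G.Strategy} :
    Q ∈ departures s e i ↔ e ∈ (s i).1 ∧ e ∉ Q.1 := Iff.rfl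

theorem congestion_add_departures (s w : G.Profile) (e : E) :
    congestion w e + hitCount (departures s e) w = congestion s e + hitCount (arrivals s e) w := by
  classical
  unfold hitCount
  rw [congestion_eq_sum, congestion_eq_sum, Finset.card_filter, Finset.card_filter,
    ← Finset.sum_add_distrib, ← Finset.sum_add_distrib]
  refine Finset.sum_congr rfl fun i _ => ?_
  by_cases h1 : e ∈ (s i).1 <;> by_cases h2 : e ∈ (w i).1 <;>
    simp [mem_arrivals, mem_departures, h1, h2]

theorem hitCount_departures_le (s w : G.Profile) (e : E) :
    hitCount (departures s e) w ≤ congestion s e := by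
  classical
  rw [congestion_eq_card]
  unfold hitCount
  refine Finset.card_le_card fun i hi => ?_
  simp only [mem_departures, Finset.mem_filter, Finset.mem_univ, true_and] at hi ⊢
  exact hi.1

theorem congestion_add_arrivals_le (s w : G.Profile) (e : E) :
    congestion s e + hitCount (arrivals s e) w ≤ G.numPlayers := by
  classical
  rw [congestion_eq_card]
  unfold hitCount
  rw [← Finset.card_union_of_disjoint]
  · exact (Finset.card_le_univ _).trans_eq (Fintype.card_fin _)
  · rw [Finset.disjoint_left]
    intro i hi
    simp only [mem_arrivals, Finset.mem_filter, Finset.mem_univ, true_and] at hi ⊢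
    tauto

theorem strategyLatency_nonneg (s : G.Profile) (P : G.Strategy) : 0 ≤ strategyLatency s P :=
  Finset.sum_nonneg fun e _ => G.latency_nonneg e _ (Nat.cast_nonneg _)

theorem latencyAfterMove_nonneg (s : G.Profile) (i : Fin G.numPlayers) (Q : G.Strategy) :
    0 ≤ latencyAfterMove s i Q := strategyLatency_nonneg _ _

theorem latencyAfterMove_self (s : G.Profile) (i : Fin G.numPlayers) :
    latencyAfterMove s i (s i) = strategyLatency s (s i) := by
  rw [latencyAfterMove, Function.update_eq_self]

variable [Fintype E]

open Classical in
/-- The latency on the resources that player `i` newly uses after moving to `Q`. -/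
noncomputable def gainedLatency (s : G.Profile) (i : Fin G.numPlayers) (Q : G.Strategy) : ℝ :=
  ∑ e : E, if Q ∈ arrivals s e i then G.latency e (congestion s e + 1 : ℕ) else 0

open Classical in
/-- The latency on the resources that player `i` gives up when moving to `Q`. -/
noncomputable def droppedLatency (s : G.Profile) (i : Fin G.numPlayers) (Q : G.Strategy) : ℝ :=
  ∑ e : E, if Q ∈ departures s e i then G.latency e (congestion s e) else 0

theorem droppedLatency_le (s : G.Profile) (i : Fin G.numPlayers) (Q : G.Strategy) :
    droppedLatency s i Q ≤ strategyLatency s (s i) := by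
  classical
  unfold droppedLatency strategyLatency
  rw [← Finset.sum_filter]
  refine Finset.sum_le_sum_of_subset_of_nonneg (fun e he => ?_)
    fun e _ _ => G.latency_nonneg e _ (Nat.cast_nonneg _)
  exact (Finset.mem_filter.1 he).2.1

/-- Resources common to both strategies keep their congestion and cancel; this splits the
improvement into contributions of single resources. -/
theorem strategyLatency_sub_latencyAfterMove (s : G.Profile) (i : Fin G.numPlayers)
    (Q : G.Strategy) : strategyLatency s (s i) - latencyAfterMove s i Q =
      droppedLatency s i Q - gainedLatency s i Q := by
  classical
  unfold strategyLatency latencyAfterMove strategyLatency droppedLatency gainedLatency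
  have hs : ∀ (P : Finset E) (f : E → ℝ), ∑ e ∈ P, f e = ∑ e, if e ∈ P then f e else 0 :=
    fun P f => by simp
  rw [hs (s i).1, hs Q.1, ← Finset.sum_sub_distrib, ← Finset.sum_sub_distrib]
  refine Finset.sum_congr rfl fun e _ => ?_
  have h := congestion_update_add s i Q e
  by_cases h1 : e ∈ (s i).1 <;> by_cases h2 : e ∈ Q.1 <;>
    simp only [h1, h2, if_true, if_false, add_zero, mem_arrivals, mem_departures,
      not_true, not_false_eq_true, and_true, and_false, sub_zero, zero_sub,
      add_left_inj, sub_self] at h ⊢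
  · rw [h, sub_self]
  · rw [h]

theorem gainedLatency_le (s : G.Profile) (i : Fin G.numPlayers) (Q : G.Strategy) :
    gainedLatency s i Q ≤ latencyAfterMove s i Q := by
  classical
  unfold gainedLatency latencyAfterMove strategyLatency
  rw [← Finset.sum_filter]
  refine (Finset.sum_congr rfl fun e he => ?_).trans_le
    (Finset.sum_le_sum_of_subset_of_nonneg (fun e he => (Finset.mem_filter.1 he).2.2)
    fun e _ _ => G.latency_nonneg e _ (Nat.cast_nonneg _))
  have h := congestion_update_add s i Q e
  have he' := (Finset.mem_filter.1 he).2
  rw [if_neg he'.1, if_pos he'.2] at h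
  rw [← h, add_zero]

end SymmetricCongestionGame

/-! ### Change of the potential on one resource. -/

/-- Let the `a` arrivals come first and then remove `b` terms from the top. Each removed term is at
least the one that would be removed without the arrivals, by monotonicity, so the departures may be
priced from `x` downwards. -/
theorem sum_Icc_le_of_add_eq {f : ℝ → ℝ} (hf : MonotoneOn f (Set.Ici 0)) {x y a b : ℕ}
    (h : y + b = x + a) (hb : b ≤ x) :
    ∑ u ∈ Finset.Icc 1 y, f u ≤ ∑ u ∈ Finset.Icc 1 x, f u +
      (a * f (x + 1 : ℕ) + ∑ u ∈ Finset.range a, (f (x + 1 + u : ℕ) - f (x + 1 : ℕ))) +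
      (-(b * f x) + ∑ u ∈ Finset.range b, (f x - f (x - u : ℕ))) := by
  have hup : ∀ a : ℕ, ∑ u ∈ Finset.Icc 1 (x + a), f u =
      ∑ u ∈ Finset.Icc 1 x, f u + ∑ u ∈ Finset.range a, f (x + 1 + u : ℕ) := by
    intro a
    induction a with
    | zero => simp
    | succ a ih =>
      rw [← add_assoc, Finset.sum_Icc_succ_top (by omega), ih, Finset.sum_range_succ,
        show x + a + 1 = x + 1 + a by omega]
      ring
  have hdown : ∀ b : ℕ, b ≤ x + a → b ≤ x → ∑ u ∈ Finset.Icc 1 (x + a - b), f u +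
      ∑ u ∈ Finset.range b, f (x - u : ℕ) ≤ ∑ u ∈ Finset.Icc 1 (x + a), f u := by
    intro b hb hbx
    induction b with
    | zero => simp
    | succ b ih =>
      have h1 := ih (by omega) (by omega)
      obtain ⟨z, hz⟩ : ∃ z, x + a - b = z + 1 := ⟨x + a - b - 1, by omega⟩
      rw [hz, Finset.sum_Icc_succ_top (by omega)] at h1
      rw [show x + a - (b + 1) = z by omega, Finset.sum_range_succ]
      have h2 : f (x - b : ℕ) ≤ f (z + 1 : ℕ) :=
        hf (Set.mem_Ici.2 (Nat.cast_nonneg _)) (Set.mem_Ici.2 (Nat.cast_nonneg _))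
          (Nat.cast_le.2 (by omega))
      linarith
  have h1 := hdown b (by omega) hb
  rw [show x + a - b = y by omega, hup a] at h1
  simp only [Finset.sum_sub_distrib, Finset.sum_const, Finset.card_range, nsmul_eq_mul]
  linarith

/-! ### Migration probabilities and stability. -/

namespace SymmetricCongestionGame

variable {E : Type*} {G : SymmetricCongestionGame E}

open Classical in
/-- The probability that player `i`, having sampled a user of `Q`, migrates to `Q`. -/
noncomputable def migrationProb (lam d ν : ℝ) (s : G.Profile) (i : Fin G.numPlayers)
    (Q : G.Strategy) : ℝ :=
  if strategyLatency s (s i) > latencyAfterMove s i Q + ν then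
    lam / d * ((strategyLatency s (s i) - latencyAfterMove s i Q) / strategyLatency s (s i))
  else 0

variable {lam d ν : ℝ}

theorem relativeGain_mem (hν : 0 ≤ ν) {s : G.Profile} {i : Fin G.numPlayers} {Q : G.Strategy}
    (h : strategyLatency s (s i) > latencyAfterMove s i Q + ν) :
    (strategyLatency s (s i) - latencyAfterMove s i Q) / strategyLatency s (s i) ∈
      Set.Icc (0 : ℝ) 1 := by
  have h0 := latencyAfterMove_nonneg s i Q
  have hpos : 0 < strategyLatency s (s i) := by linarith
  exact ⟨div_nonneg (by linarith) hpos.le, (div_le_one hpos).2 (by linarith)⟩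

theorem migrationProb_mem (hlam : 0 ≤ lam) (hd : 1 ≤ d) (hν : 0 ≤ ν) (s : G.Profile)
    (i : Fin G.numPlayers) (Q : G.Strategy) :
    migrationProb lam d ν s i Q ∈ Set.Icc 0 (lam / d) := by
  have h0 : 0 ≤ lam / d := by positivity
  unfold migrationProb
  split_ifs with h
  · have hg := relativeGain_mem hν h
    exact ⟨mul_nonneg h0 hg.1, mul_le_of_le_one_right h0 hg.2⟩
  · exact ⟨le_rfl, h0⟩

theorem migrationLaw_real (hlam : 0 ≤ lam) (hlam1 : lam ≤ 1) (hd : 1 ≤ d) (hν : 0 ≤ ν)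
    (s : G.Profile) (i : Fin G.numPlayers) (Q : G.Strategy) {B : Set G.Strategy} (hB : s i ∉ B)
    [Decidable (Q ∈ B)] :
    (migrationLaw lam d ν s i Q).real B = if Q ∈ B then migrationProb lam d ν s i Q else 0 := by
  classical
  have hm := migrationProb_mem hlam hd hν s i Q
  have hld : lam / d ≤ 1 := (div_le_one (by linarith)).2 (by linarith)
  unfold migrationLaw
  unfold migrationProb at hm ⊢
  split_ifs with h hQ hQ
  · rw [if_pos h] at hm
    rw [bernoulliMeasure_real_apply_of_mem_of_notMem _ (MeasurableSet.of_discrete) hQ hB,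
      Set.coe_projIcc, min_eq_right (hm.2.trans hld), max_eq_right hm.1]
  · rw [bernoulliMeasure_real_apply_of_notMem_of_notMem _ (MeasurableSet.of_discrete) hQ hB]
  · simp [measureReal_def, hB]
  · simp [measureReal_def, hB]

/-- The sum may include `j = i`, because `s i ∉ B` makes that term vanish. -/
theorem playerLaw_real (hlam : 0 ≤ lam) (hlam1 : lam ≤ 1) (hd : 1 ≤ d) (hν : 0 ≤ ν)
    (s : G.Profile) (i : Fin G.numPlayers) {B : Set G.Strategy} (hB : s i ∉ B)
    [DecidablePred (· ∈ B)] : (playerLaw lam d ν s i).real B =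
      ((G.numPlayers : ℝ) - 1)⁻¹ *
        ∑ j, if s j ∈ B then migrationProb lam d ν s i (s j) else 0 := by
  have hcard : ((Finset.univ.erase i).card : ℝ) = (G.numPlayers : ℝ) - 1 := by
    rw [Finset.card_erase_of_mem (Finset.mem_univ i), Finset.card_univ, Fintype.card_fin,
      Nat.cast_sub (Fin.pos i)]
    simp
  unfold playerLaw
  split_ifs with h
  · rw [measureReal_def, Measure.bind_apply (MeasurableSet.of_discrete)
      (measurable_of_countable _).aemeasurable, lintegral_fintype, ENNReal.toReal_sum
      (fun j _ => ENNReal.mul_ne_top (measure_ne_top _ _) (measure_ne_top _ _)), Finset.mul_sum]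
    refine Finset.sum_congr rfl fun j _ => ?_
    rw [ENNReal.toReal_mul, ← measureReal_def, migrationLaw_real hlam hlam1 hd hν s i (s j) hB,
      PMF.toMeasure_apply_singleton _ _ (MeasurableSet.of_discrete), PMF.uniformOfFinset_apply]
    by_cases hj : j = i
    · subst hj
      simp [hB]
    · rw [if_pos (Finset.mem_erase.2 ⟨hj, Finset.mem_univ j⟩), ENNReal.toReal_inv,
        ENNReal.toReal_natCast, hcard, mul_comm]
  -- A single player stays, which matches the convention `0⁻¹ = 0` for the factor `(n - 1)⁻¹`.
  · rw [Finset.not_nonempty_iff_eq_empty] at h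
    rw [h] at hcard
    rw [← hcard]
    simp [measureReal_def, hB]

/-- Some player can improve by more than `ν` by imitating another one. -/
def HasImprovement (ν : ℝ) (s : G.Profile) : Prop :=
  ∃ i j, strategyLatency s (s i) > latencyAfterMove s i (s j) + ν

theorem two_le_numPlayers (hν : 0 ≤ ν) {s : G.Profile} (hs : HasImprovement ν s) :
    2 ≤ G.numPlayers := by
  obtain ⟨i, j, hij⟩ := hs
  have hji : j ≠ i := by
    rintro rfl
    rw [latencyAfterMove_self] at hij
    linarith
  have h1 : Finset.card {i, j} ≤ Fintype.card (Fin G.numPlayers) := Finset.card_le_univ _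
  rwa [Finset.card_pair hji.symm, Fintype.card_fin] at h1

theorem roundKernel_eq_dirac {s : G.Profile} (h : ¬ HasImprovement ν s) :
    G.roundKernel lam d ν s = Measure.dirac s := by
  have hplayer : ∀ i, playerLaw lam d ν s i = Measure.dirac (s i) := by
    intro i
    unfold playerLaw
    split_ifs with hne
    · have : (fun j => migrationLaw lam d ν s i (s j)) = fun _ => Measure.dirac (s i) := by
        funext j
        unfold migrationLaw
        exact if_neg fun hij => h ⟨i, j, hij⟩
      rw [this, Measure.bind_const]
      simp
    · rfl
  have h1 : ∀ᵐ w ∂(G.roundKernel lam d ν s), w = s := by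
    have h2 : ∀ i, ∀ᵐ w ∂(G.roundKernel lam d ν s), w i = s i := by
      intro i
      refine (measurePreserving_eval (playerLaw lam d ν s) i).quasiMeasurePreserving.ae
        (p := fun a => a = s i) ?_
      rw [hplayer i]
      simp [ae_dirac_eq]
    filter_upwards [ae_all_iff.2 h2] with w hw using funext hw
  rw [← Measure.map_id (μ := G.roundKernel lam d ν s), Measure.map_congr (f := id) (g := fun _ => s) h1,
    Measure.map_const]
  simp

/-- If player `i` can improve by imitating `j`, then with positive probability `i` moves and
everybody else stays, since each of the others stays with probability at least `1 - lam > 0`. This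
one move lowers the number of users of `s i`. -/
theorem isImitationStable_iff (hlam : 0 < lam) (hlam1 : lam < 1) (hd : 1 ≤ d) (hν : 0 ≤ ν)
    (s : G.Profile) : IsImitationStable lam d ν s ↔ ¬ HasImprovement ν s := by
  classical
  constructor
  · rintro hs ⟨i, j, hij⟩
    have hneq : s j ≠ s i := by
      intro h
      rw [h, latencyAfterMove_self] at hij
      linarith
    have hn : (2 : ℝ) ≤ G.numPlayers := by
      exact_mod_cast two_le_numPlayers hν ⟨i, j, hij⟩
    have hW : 0 < ((G.numPlayers : ℝ) - 1)⁻¹ := inv_pos.2 (by linarith)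
    have hpos : 0 < strategyLatency s (s i) := by
      linarith [latencyAfterMove_nonneg s i (s j)]
    have hpi : 0 < (playerLaw lam d ν s i).real {s j} := by
      rw [playerLaw_real hlam.le hlam1.le hd hν s i (by simpa using hneq.symm)]
      refine mul_pos hW (Finset.sum_pos' (fun k _ => ?_) ⟨j, Finset.mem_univ j, ?_⟩)
      · split_ifs
        exacts [(migrationProb_mem hlam.le hd hν s i _).1, le_rfl]
      · simp only [Set.mem_singleton_iff, if_true, migrationProb, if_pos hij]
        exact mul_pos (by positivity) (div_pos (by linarith) hpos)
    have hpk : ∀ k, 0 < (playerLaw lam d ν s k).real {s k} := by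
      intro k
      have h1 : (playerLaw lam d ν s k).real {s k}ᶜ < 1 := by
        rw [playerLaw_real hlam.le hlam1.le hd hν s k (by simp)]
        have h2 : ∑ l, (if s l ∈ ({s k}ᶜ : Set G.Strategy) then
            migrationProb lam d ν s k (s l) else 0) ≤ ∑ l ∈ Finset.univ.erase k, lam := by
          rw [← Finset.add_sum_erase _ _ (Finset.mem_univ k)]
          simp only [Set.mem_compl_iff, Set.mem_singleton_iff, not_true, if_false, zero_add]
          refine Finset.sum_le_sum fun l _ => ?_
          have h3 := (migrationProb_mem hlam.le hd hν s k (s l)).2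
          have h4 : lam / d ≤ lam := div_le_self hlam.le hd
          split_ifs
          exacts [hlam.le, h3.trans h4]
        rw [Finset.sum_const, Finset.card_erase_of_mem (Finset.mem_univ k), Finset.card_univ,
          Fintype.card_fin, nsmul_eq_mul, Nat.cast_sub (Fin.pos k), Nat.cast_one] at h2
        calc _ ≤ ((G.numPlayers : ℝ) - 1)⁻¹ * (((G.numPlayers : ℝ) - 1) * lam) :=
              mul_le_mul_of_nonneg_left h2 hW.le
          _ = lam := inv_mul_cancel_left₀ (by linarith) _
          _ < 1 := hlam1
      rw [probReal_compl_eq_one_sub (MeasurableSet.of_discrete)] at h1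
      linarith
    have hw : 0 < (G.roundKernel lam d ν s) {Function.update s i (s j)} := by
      change 0 < Measure.pi _ _
      rw [Measure.pi_singleton]
      refine CanonicallyOrderedAdd.prod_pos.2 fun k _ => ?_
      by_cases hk : k = i
      · subst hk
        rw [Function.update_self]
        exact (ENNReal.toReal_pos_iff.1 hpi).1
      · rw [Function.update_of_ne hk]
        exact (ENNReal.toReal_pos_iff.1 (hpk k)).1
    have hst : state (Function.update s i (s j)) = state s := by
      by_contra hne
      have h0 : (G.roundKernel lam d ν s) {w | ¬ state w = state s} = 0 := hs
      exact hw.ne' (measure_mono_null (by simpa using hne) h0)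
    have h1 := congrFun hst (s i)
    unfold state at h1
    refine (Finset.card_lt_card ?_).ne h1
    refine Finset.ssubset_iff_of_subset (fun k hk => ?_) |>.2 ⟨i, by simp, by simp [hneq]⟩
    simp only [Finset.mem_filter, Finset.mem_univ, true_and] at hk ⊢
    by_cases hki : k = i
    · rw [hki]
    · rwa [Function.update_of_ne hki] at hk
  · intro h
    unfold IsImitationStable
    rw [roundKernel_eq_dirac h, ae_dirac_eq]
    rfl

end SymmetricCongestionGame

/-! ### Second-order excess caused by simultaneous moves. -/

namespace SymmetricCongestionGame

variable {E : Type*} {G : SymmetricCongestionGame E} {lam d ν : ℝ}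

/-- The improvement of player `i` by a unilateral move to `Q`, relative to its current latency. -/
noncomputable def relativeGain (s : G.Profile) (i : Fin G.numPlayers) (Q : G.Strategy) : ℝ :=
  (strategyLatency s (s i) - latencyAfterMove s i Q) / strategyLatency s (s i)

/-- The design of the protocol enters here: as probabilities are proportional to relative gains,
second-order quantities are paid for by gains. -/
theorem migrationProb_sq (s : G.Profile) (i : Fin G.numPlayers) (Q : G.Strategy) :
    migrationProb lam d ν s i Q ^ 2 =
      lam / d * (migrationProb lam d ν s i Q * relativeGain s i Q) := by
  unfold migrationProb relativeGain
  split_ifs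
  · ring
  · simp

theorem migrationProb_mul_relativeGain_nonneg (hlam : 0 ≤ lam) (hd : 1 ≤ d) (hν : 0 ≤ ν)
    (s : G.Profile) (i : Fin G.numPlayers) (Q : G.Strategy) :
    0 ≤ migrationProb lam d ν s i Q * relativeGain s i Q := by
  have h := (migrationProb_mem hlam hd hν s i Q).1
  by_cases hi : strategyLatency s (s i) > latencyAfterMove s i Q + ν
  · exact mul_nonneg h (relativeGain_mem hν hi).1
  · simp [migrationProb, hi]

theorem inv_numPlayers_sub_one_nonneg (s : Fin G.numPlayers) :
    0 ≤ ((G.numPlayers : ℝ) - 1)⁻¹ := by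
  have : (1 : ℝ) ≤ G.numPlayers := by exact_mod_cast Fin.pos s
  exact inv_nonneg.2 (by linarith)

open Classical in
/-- The ordered pairs of players of which the first may end up in `B` by imitating the second. -/
noncomputable def imitationPairs (s : G.Profile) (B : Fin G.numPlayers → Set G.Strategy) :
    Finset (Fin G.numPlayers × Fin G.numPlayers) :=
  {p | s p.2 ∈ B p.1}

theorem card_imitationPairs_arrivals (s : G.Profile) (e : E) :
    (imitationPairs s (arrivals s e)).card =
      (G.numPlayers - congestion s e) * congestion s e := by
  classical
  have h : imitationPairs s (arrivals s e) =
      ({i | e ∈ (s i).1} : Finset (Fin G.numPlayers))ᶜ ×ˢ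
        ({i | e ∈ (s i).1} : Finset (Fin G.numPlayers)) := by
    ext p
    simp [imitationPairs, mem_arrivals]
  rw [h, Finset.card_product, Finset.card_compl, Fintype.card_fin, congestion_eq_card]

theorem card_imitationPairs_departures (s : G.Profile) (e : E) :
    (imitationPairs s (departures s e)).card =
      (G.numPlayers - congestion s e) * congestion s e := by
  classical
  have h : imitationPairs s (departures s e) =
      ({i | e ∈ (s i).1} : Finset (Fin G.numPlayers)) ×ˢ
        ({i | e ∈ (s i).1} : Finset (Fin G.numPlayers))ᶜ := by
    ext p
    simp [imitationPairs, mem_departures]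
  rw [h, Finset.card_product, Finset.card_compl, Fintype.card_fin, congestion_eq_card, mul_comm]

/-- The expected number of players that move into `B`. -/
noncomputable def expectedMoves (lam d ν : ℝ) (s : G.Profile)
    (B : Fin G.numPlayers → Set G.Strategy) : ℝ :=
  ((G.numPlayers : ℝ) - 1)⁻¹ * ∑ p ∈ imitationPairs s B, migrationProb lam d ν s p.1 (s p.2)

/-- The expected number of players that move into `B`, weighted by their relative gains. -/
noncomputable def expectedGain (lam d ν : ℝ) (s : G.Profile)
    (B : Fin G.numPlayers → Set G.Strategy) : ℝ :=
  ((G.numPlayers : ℝ) - 1)⁻¹ * ∑ p ∈ imitationPairs s B,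
    migrationProb lam d ν s p.1 (s p.2) * relativeGain s p.1 (s p.2)

theorem sum_playerLaw_real (hlam : 0 ≤ lam) (hlam1 : lam ≤ 1) (hd : 1 ≤ d) (hν : 0 ≤ ν)
    (s : G.Profile) {B : Fin G.numPlayers → Set G.Strategy} (hB : ∀ i, s i ∉ B i) :
    ∑ i, (playerLaw lam d ν s i).real (B i) = expectedMoves lam d ν s B := by
  classical
  unfold expectedMoves imitationPairs
  rw [Finset.sum_filter, Fintype.sum_prod_type, Finset.mul_sum]
  refine Finset.sum_congr rfl fun i _ => ?_
  rw [playerLaw_real hlam hlam1 hd hν s i (hB i)]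

theorem imitationPairs_cases (s : G.Profile) (B : Fin G.numPlayers → Set G.Strategy) (P : Prop)
    (h0 : imitationPairs s B = ∅ → P)
    (h1 : 0 ≤ ((G.numPlayers : ℝ) - 1)⁻¹ → P) : P := by
  rcases (imitationPairs s B).eq_empty_or_nonempty with h | ⟨p, _⟩
  · exact h0 h
  · exact h1 (inv_numPlayers_sub_one_nonneg p.1)

/-- For `1 ≤ x` the factor `n - x` is at most `n - 1`; for `n ≤ 1` there are no pairs. -/
theorem inv_mul_card_imitationPairs_le (s : G.Profile)
    {B : Fin G.numPlayers → Set G.Strategy} {x : ℕ}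
    (hcard : (imitationPairs s B).card = (G.numPlayers - x) * x) :
    ((G.numPlayers : ℝ) - 1)⁻¹ * ((imitationPairs s B).card : ℝ) ≤ x := by
  rw [hcard]
  rcases Nat.eq_zero_or_pos x with hx | hx
  · simp [hx]
  rcases Nat.lt_or_ge G.numPlayers 2 with hn | hn
  · have h1 : (G.numPlayers - x) * x = 0 := by
      rw [Nat.sub_eq_zero_of_le (by omega), zero_mul]
    rw [h1]
    simp
  · have hn' : (0 : ℝ) < (G.numPlayers : ℝ) - 1 := by
      have : (2 : ℝ) ≤ G.numPlayers := by exact_mod_cast hn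
      linarith
    rw [inv_mul_le_iff₀ hn']
    have h1 : (G.numPlayers - x) * x ≤ (G.numPlayers - 1) * x := Nat.mul_le_mul_right _ (by omega)
    have h2 : (((G.numPlayers - 1) * x : ℕ) : ℝ) = ((G.numPlayers : ℝ) - 1) * x := by
      rw [Nat.cast_mul, Nat.cast_sub (by omega), Nat.cast_one]
    rw [← h2]
    exact_mod_cast h1

theorem expectedMoves_nonneg (hlam : 0 ≤ lam) (hd : 1 ≤ d) (hν : 0 ≤ ν) (s : G.Profile)
    (B : Fin G.numPlayers → Set G.Strategy) : 0 ≤ expectedMoves lam d ν s B := by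
  refine imitationPairs_cases s B _ (fun h => by simp [expectedMoves, h]) fun h => ?_
  exact mul_nonneg h (Finset.sum_nonneg fun p _ => (migrationProb_mem hlam hd hν s _ _).1)

theorem expectedGain_nonneg (hlam : 0 ≤ lam) (hd : 1 ≤ d) (hν : 0 ≤ ν) (s : G.Profile)
    (B : Fin G.numPlayers → Set G.Strategy) : 0 ≤ expectedGain lam d ν s B := by
  refine imitationPairs_cases s B _ (fun h => by simp [expectedGain, h]) fun h => ?_
  exact mul_nonneg h (Finset.sum_nonneg fun p _ =>
    migrationProb_mul_relativeGain_nonneg hlam hd hν s _ _)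

theorem expectedMoves_le (hlam : 0 ≤ lam) (hd : 1 ≤ d) (hν : 0 ≤ ν) (s : G.Profile)
    {B : Fin G.numPlayers → Set G.Strategy} {x : ℕ}
    (hcard : (imitationPairs s B).card = (G.numPlayers - x) * x) : expectedMoves lam d ν s B ≤ lam / d * x := by
  have hld : 0 ≤ lam / d := by positivity
  refine imitationPairs_cases s B _ (fun h => ?_) fun h => ?_
  · simp only [expectedMoves, h, Finset.sum_empty, mul_zero]
    positivity
  calc expectedMoves lam d ν s B
      ≤ ((G.numPlayers : ℝ) - 1)⁻¹ * ∑ p ∈ imitationPairs s B, lam / d :=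
        mul_le_mul_of_nonneg_left
          (Finset.sum_le_sum fun p _ => (migrationProb_mem hlam hd hν s _ _).2) h
    _ = lam / d * (((G.numPlayers : ℝ) - 1)⁻¹ * ((imitationPairs s B).card : ℝ)) := by
        rw [Finset.sum_const, nsmul_eq_mul]; ring
    _ ≤ lam / d * x :=
        mul_le_mul_of_nonneg_left (inv_mul_card_imitationPairs_le s hcard) hld

/-- Cauchy–Schwarz over the pairs, followed by `migrationProb_sq` and the count of pairs. -/
theorem expectedMoves_sq_le (hlam : 0 ≤ lam) (hd : 1 ≤ d) (hν : 0 ≤ ν) (s : G.Profile)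
    {B : Fin G.numPlayers → Set G.Strategy} {x : ℕ}
    (hcard : (imitationPairs s B).card = (G.numPlayers - x) * x) :
    expectedMoves lam d ν s B ^ 2 ≤ lam / d * x * expectedGain lam d ν s B := by
  have hld : 0 ≤ lam / d := by positivity
  refine imitationPairs_cases s B _ (fun h => by simp [expectedMoves, expectedGain, h])
    fun h => ?_
  have hW := inv_mul_card_imitationPairs_le s hcard
  have hCS := sq_sum_le_card_mul_sum_sq (s := imitationPairs s B)
    (f := fun p => migrationProb lam d ν s p.1 (s p.2))
  simp only [migrationProb_sq, ← Finset.mul_sum] at hCS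
  unfold expectedMoves expectedGain
  set T := ∑ p ∈ imitationPairs s B,
    migrationProb lam d ν s p.1 (s p.2) * relativeGain s p.1 (s p.2)
  have hT : 0 ≤ T := Finset.sum_nonneg fun p _ =>
    migrationProb_mul_relativeGain_nonneg hlam hd hν s _ _
  set W := ((G.numPlayers : ℝ) - 1)⁻¹
  calc (W * ∑ p ∈ imitationPairs s B, migrationProb lam d ν s p.1 (s p.2)) ^ 2
      = W ^ 2 * (∑ p ∈ imitationPairs s B, migrationProb lam d ν s p.1 (s p.2)) ^ 2 := by ring
    _ ≤ W ^ 2 * (((imitationPairs s B).card : ℝ) * (lam / d * T)) :=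
        mul_le_mul_of_nonneg_left hCS (sq_nonneg _)
    _ = (W * ((imitationPairs s B).card : ℝ)) * (W * (lam / d * T)) := by ring
    _ ≤ x * (W * (lam / d * T)) :=
        mul_le_mul_of_nonneg_right hW (by positivity)
    _ = lam / d * x * (W * T) := by ring

theorem notMem_arrivals (s : G.Profile) (e : E) (i : Fin G.numPlayers) : s i ∉ arrivals s e i :=
  fun h => h.1 h.2

theorem notMem_departures (s : G.Profile) (e : E) (i : Fin G.numPlayers) :
    s i ∉ departures s e i := fun h => h.2 h.1

theorem sub_le_slope (d : ℝ) (e : E) {u : ℕ} (hu : 1 ≤ u) (hud : u ≤ ⌊d⌋₊) :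
    G.latency e u - G.latency e (u - 1) ≤ G.slope d e :=
  le_csSup ((Set.finite_Icc 1 ⌊d⌋₊).image _).bddAbove ⟨u, ⟨hu, hud⟩, rfl⟩

theorem slope_nonneg (hd : 1 ≤ d) (e : E) : 0 ≤ G.slope d e := by
  refine le_trans ?_ (sub_le_slope d e le_rfl (Nat.le_floor (by simpa using hd)))
  refine sub_nonneg.2 (G.latency_mono e ?_ ?_ ?_) <;> simp

theorem integral_arrivals_excess_le (hlam : 0 ≤ lam) (hlam8 : lam ≤ 1 / 8) (hd : 1 ≤ d)
    (hν : 0 ≤ ν) (hel : G.IsElasticityBound d) (s : G.Profile) (e : E) :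
    ∫ w, (∑ u ∈ Finset.range (hitCount (arrivals s e) w),
      (G.latency e (congestion s e + 1 + u : ℕ) - G.latency e (congestion s e + 1 : ℕ)))
        ∂(Measure.pi fun i => playerLaw lam d ν s i) ≤
      8 * lam * (expectedGain lam d ν s (arrivals s e) * G.latency e (congestion s e + 1 : ℕ) +
        expectedMoves lam d ν s (arrivals s e) * G.slope d e) := by
  have hcard := card_imitationPairs_arrivals s e
  have hM := sum_playerLaw_real hlam (by linarith) hd hν s (notMem_arrivals s e)
  have hM0 := expectedMoves_nonneg hlam hd hν s (arrivals s e)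
  have hg0 := expectedGain_nonneg hlam hd hν s (arrivals s e)
  have hMx := expectedMoves_le hlam hd hν s hcard
  have hMsq := expectedMoves_sq_le hlam hd hν s hcard
  have hσ := slope_nonneg (G := G) hd e
  have hn : ∀ (w : G.Profile) (u : ℕ), u < hitCount (arrivals s e) w →
      ((congestion s e + 1 + u : ℕ) : ℝ) ≤ G.numPlayers := by
    intro w u hu
    have := congestion_add_arrivals_le s w e
    exact_mod_cast (show congestion s e + 1 + u ≤ G.numPlayers by omega)
  set x := congestion s e
  set M := expectedMoves lam d ν s (arrivals s e)
  set g := expectedGain lam d ν s (arrivals s e)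
  have hf := G.latency_pos e ((x + 1 : ℕ) : ℝ) (by positivity)
  have hd0 : 0 < d := by linarith
  have hbound : ∀ {β c : ℝ}, 0 < β → β ≤ 2 → M * β ≤ 1 / 4 → (∀ (w : G.Profile) (u : ℕ),
      u < hitCount (arrivals s e) w →
      G.latency e (x + 1 + u : ℕ) - G.latency e (x + 1 : ℕ) ≤ c * (Real.exp (β * u) - 1)) →
      0 ≤ c →
      ∫ w, (∑ u ∈ Finset.range (hitCount (arrivals s e) w),
        (G.latency e (x + 1 + u : ℕ) - G.latency e (x + 1 : ℕ)))
          ∂(Measure.pi fun i => playerLaw lam d ν s i) ≤ c * (4 * β * M ^ 2) := by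
    intro β c hβ hβ2 hMβ hle hc
    refine (integral_mono (integrable_of_discrete _ _) (integrable_of_discrete _ _)
      (g := fun w => c * ∑ u ∈ Finset.range (hitCount (arrivals s e) w),
        (Real.exp (β * u) - 1)) fun w => ?_).trans ?_
    · simp only [Finset.mul_sum]
      exact Finset.sum_le_sum fun u hu => hle w u (Finset.mem_range.1 hu)
    · rw [integral_const_mul]
      exact mul_le_mul_of_nonneg_left (integral_sum_exp_sub_one_le _ _ hβ hβ2 hM hMβ) hc
  -- Below `⌊d⌋` the rate is `2`, and `x ≤ d` gives both `M² ≤ lam * g` and `M² ≤ lam * M`, one for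
  -- each summand of the coefficient. From `⌊d⌋` on the rate is `d / (x + 1) ≤ 1`, and the factor
  -- `x` in the bound on `M²` cancels against it.
  rcases Nat.lt_or_ge x ⌊d⌋₊ with hx | hx
  · have hxd : (x : ℝ) ≤ d := (Nat.cast_le.2 hx.le).trans (Nat.floor_le hd0.le)
    have hMlam : M ≤ lam := by
      refine hMx.trans ?_
      rw [div_mul_eq_mul_div, div_le_iff₀ hd0]
      exact mul_le_mul_of_nonneg_left hxd hlam
    refine (hbound two_pos le_rfl (by linarith) (fun w u hu => sub_le_of_slope_le hd
      (G.latency_pos e) (G.latency_diff e) (hel e) hσ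
      (fun v hv hvd => sub_le_slope d e hv hvd) hx (hn w u hu)) (by positivity)).trans ?_
    have h1 : M ^ 2 ≤ lam * g := by
      refine hMsq.trans (mul_le_mul_of_nonneg_right ?_ hg0)
      rw [div_mul_eq_mul_div, div_le_iff₀ hd0]
      exact mul_le_mul_of_nonneg_left hxd hlam
    have h2 : M ^ 2 ≤ lam * M := by nlinarith
    nlinarith [mul_le_mul_of_nonneg_left h1 hf.le, mul_le_mul_of_nonneg_left h2 hσ]
  · have hdx : d < x + 1 := (Nat.lt_floor_add_one d).trans_le (by exact_mod_cast Nat.succ_le_succ hx)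
    have hx0 : (0 : ℝ) < (x : ℝ) + 1 := by positivity
    have hβ1 : d / (x + 1) ≤ 1 := (div_le_one hx0).2 hdx.le
    have hxβ : lam / d * x * (d / (x + 1)) ≤ lam := by
      have h1 : lam / d * x * (d / (x + 1)) = lam * (x / (x + 1)) := by field_simp
      rw [h1]
      exact mul_le_of_le_one_right hlam ((div_le_one hx0).2 (by linarith))
    have hβ0 : 0 < d / ((x : ℝ) + 1) := by positivity
    refine (hbound (β := d / (x + 1)) (c := G.latency e (x + 1 : ℕ)) hβ0 (by linarith) ?_
      (fun w u hu => ?_) hf.le).trans ?_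
    · exact (mul_le_mul_of_nonneg_right hMx hβ0.le).trans (by linarith)
    · have h := le_mul_exp_of_elasticity_le hd0.le (G.latency_pos e) (G.latency_diff e) (hel e)
        (a := ((x + 1 : ℕ) : ℝ)) (b := ((x + 1 + u : ℕ) : ℝ)) (by positivity)
        (by exact_mod_cast Nat.le_add_right _ _) (hn w u hu)
      rw [show ((x + 1 + u : ℕ) : ℝ) - ((x + 1 : ℕ) : ℝ) = u by push_cast; ring] at h
      rw [show ((x : ℝ) + 1) = ((x + 1 : ℕ) : ℝ) by push_cast; ring]
      linarith
    · have h1 : d / (x + 1) * M ^ 2 ≤ lam * g := by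
        calc d / (x + 1) * M ^ 2 ≤ d / (x + 1) * (lam / d * x * g) :=
              mul_le_mul_of_nonneg_left hMsq hβ0.le
          _ = lam / d * x * (d / (x + 1)) * g := by ring
          _ ≤ lam * g := mul_le_mul_of_nonneg_right hxβ hg0
      have h2 := mul_le_mul_of_nonneg_left h1 hf.le
      have h3 : 0 ≤ lam * (M * G.slope d e) := by positivity
      have h4 : 0 ≤ G.latency e (x + 1 : ℕ) * (lam * g) := by positivity
      nlinarith

theorem integral_departures_excess_le (hlam : 0 ≤ lam) (hlam8 : lam ≤ 1 / 8) (hd : 1 ≤ d)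
    (hν : 0 ≤ ν) (hel : G.IsElasticityBound d) (s : G.Profile) (e : E) :
    ∫ w, (∑ u ∈ Finset.range (hitCount (departures s e) w),
      (G.latency e (congestion s e) - G.latency e (congestion s e - u : ℕ)))
        ∂(Measure.pi fun i => playerLaw lam d ν s i) ≤
      4 * lam * (expectedGain lam d ν s (departures s e) * G.latency e (congestion s e)) := by
  have hcard := card_imitationPairs_departures s e
  have hM := sum_playerLaw_real hlam (by linarith) hd hν s (notMem_departures s e)
  have hM0 := expectedMoves_nonneg hlam hd hν s (departures s e)
  have hg0 := expectedGain_nonneg hlam hd hν s (departures s e)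
  have hMx := expectedMoves_le hlam hd hν s hcard
  have hMsq := expectedMoves_sq_le hlam hd hν s hcard
  have hle := fun w => hitCount_departures_le s w e
  have hxn : ((congestion s e : ℕ) : ℝ) ≤ G.numPlayers := by exact_mod_cast congestion_le s e
  have hd0 : 0 < d := by linarith
  have hf := G.latency_nonneg e (congestion s e) (Nat.cast_nonneg _)
  set x := congestion s e
  set M := expectedMoves lam d ν s (departures s e)
  set g := expectedGain lam d ν s (departures s e)
  rcases Nat.eq_zero_or_pos x with hx | hx
  · have : ∀ w, hitCount (departures s e) w = 0 := fun w => by have := hle w; omega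
    simp only [this, Finset.range_zero, Finset.sum_empty, integral_zero]
    positivity
  have hx0 : (0 : ℝ) < x := by exact_mod_cast hx
  have hβ0 : 0 < d / (x : ℝ) := by positivity
  -- The increments are bounded linearly in `u`, so the auxiliary rate `b` cancels in the end. It
  -- only has to be small enough for the exponential moment bound.
  obtain ⟨b, hb0, hb2, hbβ⟩ : ∃ b : ℝ, 0 < b ∧ b ≤ 2 ∧ b ≤ d / x :=
    ⟨min 1 (d / x), lt_min one_pos hβ0, (min_le_left _ _).trans one_le_two, min_le_right _ _⟩
  have hMd : M * (d / x) ≤ lam := by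
    calc M * (d / x) ≤ lam / d * x * (d / x) := mul_le_mul_of_nonneg_right hMx hβ0.le
      _ = lam := by field_simp
  have hMb : M * b ≤ 1 / 4 := (mul_le_mul_of_nonneg_left hbβ hM0).trans (by linarith)
  have hpt : ∀ (w : G.Profile) (u : ℕ), u < hitCount (departures s e) w →
      G.latency e x - G.latency e (x - u : ℕ) ≤
        d / x / b * G.latency e x * (Real.exp (b * u) - 1) := by
    intro w u hu
    have hux : u < x := hu.trans_le (hle w)
    have h := sub_le_of_elasticity_le hd (G.latency_pos e) (G.latency_diff e) (hel e)
      (a := ((x - u : ℕ) : ℝ)) (b := (x : ℝ)) (by exact_mod_cast Nat.sub_pos_of_lt hux)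
      (by exact_mod_cast Nat.sub_le _ _) hxn
    rw [show (x : ℝ) - ((x - u : ℕ) : ℝ) = u by rw [Nat.cast_sub hux.le]; ring] at h
    have h1 : b * u ≤ Real.exp (b * u) - 1 := by linarith [Real.add_one_le_exp (b * (u : ℝ))]
    calc _ ≤ d / x * u * G.latency e x := h
      _ = d / x / b * G.latency e x * (b * u) := by field_simp
      _ ≤ _ := mul_le_mul_of_nonneg_left h1 (by positivity)
  refine (integral_mono (integrable_of_discrete _ _) (integrable_of_discrete _ _)
    (g := fun w => d / x / b * G.latency e x *
      ∑ u ∈ Finset.range (hitCount (departures s e) w), (Real.exp (b * u) - 1))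
      fun w => ?_).trans ?_
  · simp only [Finset.mul_sum]
    exact Finset.sum_le_sum fun u hu => hpt w u (Finset.mem_range.1 hu)
  · rw [integral_const_mul]
    refine (mul_le_mul_of_nonneg_left (integral_sum_exp_sub_one_le _ _ hb0 hb2 hM hMb)
      (by positivity)).trans ?_
    calc d / x / b * G.latency e x * (4 * b * M ^ 2)
        = 4 * G.latency e x * (d / x) * M ^ 2 := by field_simp
      _ ≤ 4 * G.latency e x * (d / x) * (lam / d * x * g) :=
          mul_le_mul_of_nonneg_left hMsq (by positivity)
      _ = 4 * lam * (g * G.latency e x) := by field_simp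

theorem strategyLatency_le_maxLatency (s : G.Profile) (P : G.Strategy) :
    strategyLatency s P ≤ G.maxLatency := by
  classical
  exact le_ciSup (f := fun p : G.Profile × G.Strategy => strategyLatency p.1 p.2)
    (Set.finite_range _).bddAbove (s, P)

theorem maxLatency_nonneg : 0 ≤ G.maxLatency :=
  Real.iSup_nonneg fun p => strategyLatency_nonneg p.1 p.2

/-- A finite expectation makes the stable time almost surely finite, and stable profiles are
absorbing. -/
theorem convergesInExpectedTime_of_lintegral_le (hlam : 0 < lam) (hlam1 : lam < 1) (hd : 1 ≤ d)
    (hν : 0 ≤ ν) {s : G.Profile} {T : ℝ}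
    (h : ∫⁻ w, stableTime lam d ν w ∂(imitationDynamics lam d ν s) ≤ ENNReal.ofReal T) :
    ConvergesInExpectedTime lam d ν s T := by
  classical
  refine ⟨?_, h⟩
  have hmeas : Measurable (stableTime (G := G) lam d ν) := by
    refine Measurable.iInf fun t => ?_
    exact (measurable_of_countable fun y : G.Profile =>
      ⨅ (_ : IsImitationStable lam d ν y), (t : ℝ≥0∞)).comp (measurable_pi_apply t)
  have h1 := ae_lt_top hmeas (h.trans_lt ENNReal.ofReal_lt_top).ne
  have h2 := ae_markovChainLaw_absorbed (G.roundKernel lam d ν) s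
    (S := {y | IsImitationStable lam d ν y})
    (fun y hy => roundKernel_eq_dirac ((isImitationStable_iff hlam hlam1 hd hν y).1 hy))
  filter_upwards [h1, h2] with w hw1 hw2
  obtain ⟨t₀, ht₀⟩ : ∃ t₀, IsImitationStable lam d ν (w t₀) := by
    by_contra hno
    push Not at hno
    simp [stableTime, hno] at hw1
  exact ⟨t₀, ht₀, fun t ht => by rw [hw2 t₀ ht₀ t ht]⟩

/-- The expected sum of the improvements of all players, as if they moved one at a time. -/
noncomputable def virtualGain (lam d ν : ℝ) (s : G.Profile) : ℝ :=
  ((G.numPlayers : ℝ) - 1)⁻¹ * ∑ p : Fin G.numPlayers × Fin G.numPlayers,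
    migrationProb lam d ν s p.1 (s p.2) *
      (strategyLatency s (s p.1) - latencyAfterMove s p.1 (s p.2))

theorem le_virtualGain (hlam : 0 ≤ lam) (hd : 1 ≤ d) (hν : 0 ≤ ν) {s : G.Profile}
    (hs : HasImprovement ν s) :
    lam * ν ^ 2 / (d * G.numPlayers * G.maxLatency) ≤ virtualGain lam d ν s := by
  obtain ⟨i, j, hij⟩ := hs
  have hL : 0 < strategyLatency s (s i) := by linarith [latencyAfterMove_nonneg s i (s j)]
  have hLm := strategyLatency_le_maxLatency s (s i)
  have hn : (2 : ℝ) ≤ G.numPlayers := by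
    exact_mod_cast two_le_numPlayers hν ⟨i, j, hij⟩
  -- One improving pair suffices: its improvement exceeds `ν` and enters squared, once through the
  -- migration probability.
  have hterm : lam / d * (ν ^ 2 / G.maxLatency) ≤ migrationProb lam d ν s i (s j) *
      (strategyLatency s (s i) - latencyAfterMove s i (s j)) := by
    rw [migrationProb, if_pos hij]
    have h1 : ν ≤ strategyLatency s (s i) - latencyAfterMove s i (s j) := by linarith
    rw [mul_assoc]
    refine mul_le_mul_of_nonneg_left ?_ (by positivity)
    rw [div_mul_eq_mul_div, ← sq]
    gcongr
  have hsum : lam / d * (ν ^ 2 / G.maxLatency) ≤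
      ∑ p : Fin G.numPlayers × Fin G.numPlayers, migrationProb lam d ν s p.1 (s p.2) *
        (strategyLatency s (s p.1) - latencyAfterMove s p.1 (s p.2)) := by
    have hnn : ∀ p : Fin G.numPlayers × Fin G.numPlayers, 0 ≤ migrationProb lam d ν s p.1 (s p.2) *
        (strategyLatency s (s p.1) - latencyAfterMove s p.1 (s p.2)) := by
      intro p
      by_cases h : strategyLatency s (s p.1) > latencyAfterMove s p.1 (s p.2) + ν
      · exact mul_nonneg (migrationProb_mem hlam hd hν s _ _).1 (by linarith)
      · simp [migrationProb, h]
    have hsingle : ∀ a : Fin G.numPlayers × Fin G.numPlayers → ℝ, (∀ p, 0 ≤ a p) →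
        a (i, j) ≤ ∑ p, a p :=
      fun a ha => Finset.single_le_sum (fun p _ => ha p) (Finset.mem_univ _)
    exact hterm.trans (hsingle _ hnn)
  calc lam * ν ^ 2 / (d * G.numPlayers * G.maxLatency)
      = (G.numPlayers : ℝ)⁻¹ * (lam / d * (ν ^ 2 / G.maxLatency)) := by
        rw [div_eq_mul_inv, mul_inv, mul_inv, div_eq_mul_inv, div_eq_mul_inv]; ring
    _ ≤ ((G.numPlayers : ℝ) - 1)⁻¹ * (lam / d * (ν ^ 2 / G.maxLatency)) := by
        have hm : 0 < G.maxLatency := hL.trans_le hLm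
        refine mul_le_mul_of_nonneg_right ?_ (by positivity)
        exact inv_anti₀ (by linarith) (by linarith)
    _ ≤ _ := mul_le_mul_of_nonneg_left hsum (inv_nonneg.2 (by linarith))

end SymmetricCongestionGame

/-! ### Drift of the potential and convergence time. -/

namespace SymmetricCongestionGame

variable {E : Type*} [Fintype E] {G : SymmetricCongestionGame E} {lam d ν : ℝ}

open Classical in
theorem sum_sum_imitationPairs_mul (s : G.Profile) (B : E → Fin G.numPlayers → Set G.Strategy)
    (W : ℝ) (a : Fin G.numPlayers × Fin G.numPlayers → ℝ) (F : E → ℝ) :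
    ∑ e, (W * ∑ p ∈ imitationPairs s (B e), a p) * F e =
      W * ∑ p, a p * ∑ e, if s p.2 ∈ B e p.1 then F e else 0 := by
  simp only [imitationPairs, Finset.sum_filter, Finset.mul_sum, Finset.sum_mul]
  rw [Finset.sum_comm]
  refine Finset.sum_congr rfl fun p _ => Finset.sum_congr rfl fun e _ => ?_
  split_ifs <;> ring

open Classical in
theorem sum_slope_le (hd : 1 ≤ d) (hsl : G.IsSlopeBound d ν) (s : G.Profile)
    (i : Fin G.numPlayers) (Q : G.Strategy) :
    ∑ e, (if Q ∈ arrivals s e i then G.slope d e else 0) ≤ ν := by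
  refine le_trans ?_ (hsl Q.1 Q.2)
  rw [← Finset.sum_filter]
  exact Finset.sum_le_sum_of_subset_of_nonneg (fun e he => (Finset.mem_filter.1 he).2.2)
    fun e _ _ => slope_nonneg hd e

theorem potential_le (s w : G.Profile) :
    potential w ≤ potential s + ∑ e,
      ((hitCount (arrivals s e) w * G.latency e (congestion s e + 1 : ℕ) +
        ∑ u ∈ Finset.range (hitCount (arrivals s e) w),
          (G.latency e (congestion s e + 1 + u : ℕ) - G.latency e (congestion s e + 1 : ℕ))) +
      (-(hitCount (departures s e) w * G.latency e (congestion s e)) +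
        ∑ u ∈ Finset.range (hitCount (departures s e) w),
          (G.latency e (congestion s e) - G.latency e (congestion s e - u : ℕ)))) := by
  unfold potential
  rw [← Finset.sum_add_distrib]
  refine Finset.sum_le_sum fun e _ => ?_
  rw [← add_assoc]
  exact sum_Icc_le_of_add_eq (G.latency_mono e) (congestion_add_departures s w e)
    (hitCount_departures_le s w e)

theorem virtualGain_term_le (hlam : 0 ≤ lam) (hlam40 : lam ≤ 1 / 40) (hd : 1 ≤ d) (hν : 0 ≤ ν)
    (s : G.Profile) (i : Fin G.numPlayers) (Q : G.Strategy) {N : ℝ} (hN : N ≤ ν) :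
    migrationProb lam d ν s i Q * gainedLatency s i Q +
      8 * lam * (migrationProb lam d ν s i Q * relativeGain s i Q * gainedLatency s i Q +
        migrationProb lam d ν s i Q * N) -
      migrationProb lam d ν s i Q * droppedLatency s i Q +
      4 * lam * (migrationProb lam d ν s i Q * relativeGain s i Q * droppedLatency s i Q) ≤
    -(1 / 2) * (migrationProb lam d ν s i Q *
      (strategyLatency s (s i) - latencyAfterMove s i Q)) := by
  by_cases h : strategyLatency s (s i) > latencyAfterMove s i Q + ν
  swap
  · simp [migrationProb, h]
  have hm := (migrationProb_mem hlam hd hν s i Q).1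
  have h0 := latencyAfterMove_nonneg s i Q
  have hL : 0 < strategyLatency s (s i) := by linarith
  have hγ : 0 ≤ relativeGain s i Q := (relativeGain_mem hν h).1
  have hγL : relativeGain s i Q * strategyLatency s (s i) =
      strategyLatency s (s i) - latencyAfterMove s i Q := div_mul_cancel₀ _ hL.ne'
  have hdiff := strategyLatency_sub_latencyAfterMove s i Q
  have hg := gainedLatency_le s i Q
  have hdr := droppedLatency_le s i Q
  set m := migrationProb lam d ν s i Q
  set γ := relativeGain s i Q
  set L := strategyLatency s (s i)
  set I := L - latencyAfterMove s i Q
  have hI : ν ≤ I := by linarith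
  have h1 : γ * gainedLatency s i Q ≤ I :=
    (mul_le_mul_of_nonneg_left (by linarith) hγ).trans_eq hγL
  have h2 : γ * droppedLatency s i Q ≤ I :=
    (mul_le_mul_of_nonneg_left hdr hγ).trans_eq hγL
  -- Each of the three terms is at most its coefficient times the improvement `I`, and `8 + 8 + 4 =
  -- 20`; the threshold `1 / 40` makes the total at most `I / 2`.
  have h3 : lam * (8 * (γ * gainedLatency s i Q) + 8 * N + 4 * (γ * droppedLatency s i Q)) ≤
      lam * (20 * I) := mul_le_mul_of_nonneg_left (by linarith) hlam
  have h4 : lam * (20 * I) ≤ 1 / 40 * (20 * I) :=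
    mul_le_mul_of_nonneg_right hlam40 (by linarith)
  have h5 := mul_le_mul_of_nonneg_left (h3.trans h4) hm
  have h6 : m * gainedLatency s i Q - m * droppedLatency s i Q = -(m * I) := by
    rw [hdiff]; ring
  nlinarith

/-- The expected potential drops by at least half of the virtual gain in every round. -/
theorem integral_potential_le (hlam : 0 ≤ lam) (hlam40 : lam ≤ 1 / 40) (hd : 1 ≤ d) (hν : 0 ≤ ν)
    (hel : G.IsElasticityBound d) (hsl : G.IsSlopeBound d ν) (s : G.Profile) :
    ∫ w, potential w ∂(G.roundKernel lam d ν s) ≤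
      potential s - 1 / 2 * virtualGain lam d ν s := by
  classical
  change ∫ w, potential w ∂(Measure.pi fun i => playerLaw lam d ν s i) ≤ _
  set μ := Measure.pi fun i => playerLaw lam d ν s i
  have hI : ∀ f : G.Profile → ℝ, Integrable f μ := fun f => integrable_of_discrete μ f
  have hA : ∀ e, ∫ w, (hitCount (arrivals s e) w : ℝ) ∂μ = expectedMoves lam d ν s (arrivals s e) :=
    fun e => (integral_hitCount _ _).trans
      (sum_playerLaw_real hlam (by linarith) hd hν s (notMem_arrivals s e))
  have hD : ∀ e, ∫ w, (hitCount (departures s e) w : ℝ) ∂μ =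
      expectedMoves lam d ν s (departures s e) :=
    fun e => (integral_hitCount _ _).trans
      (sum_playerLaw_real hlam (by linarith) hd hν s (notMem_departures s e))
  have h1 := integral_mono (hI _) (hI _) (potential_le s)
  rw [integral_add (hI _) (hI _), integral_const, probReal_univ, one_smul,
    integral_finsetSum _ fun e _ => hI _] at h1
  have h2 : ∀ e, ∫ w, ((hitCount (arrivals s e) w * G.latency e (congestion s e + 1 : ℕ) +
        ∑ u ∈ Finset.range (hitCount (arrivals s e) w),
          (G.latency e (congestion s e + 1 + u : ℕ) - G.latency e (congestion s e + 1 : ℕ))) +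
      (-(hitCount (departures s e) w * G.latency e (congestion s e)) +
        ∑ u ∈ Finset.range (hitCount (departures s e) w),
          (G.latency e (congestion s e) - G.latency e (congestion s e - u : ℕ)))) ∂μ ≤
      expectedMoves lam d ν s (arrivals s e) * G.latency e (congestion s e + 1 : ℕ) +
      8 * lam * (expectedGain lam d ν s (arrivals s e) * G.latency e (congestion s e + 1 : ℕ) +
        expectedMoves lam d ν s (arrivals s e) * G.slope d e) -
      expectedMoves lam d ν s (departures s e) * G.latency e (congestion s e) +
      4 * lam * (expectedGain lam d ν s (departures s e) * G.latency e (congestion s e)) := by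
    intro e
    rw [integral_add (hI _) (hI _), integral_add (hI _) (hI _), integral_add (hI _) (hI _),
      integral_neg, integral_mul_const, integral_mul_const, hA, hD]
    have h3 := integral_arrivals_excess_le hlam (by linarith) hd hν hel s e
    have h4 := integral_departures_excess_le hlam (by linarith) hd hν hel s e
    linarith
  have h3 := h1.trans (add_le_add_right (Finset.sum_le_sum fun e _ => h2 e) _)
  simp only [Finset.sum_add_distrib, Finset.sum_sub_distrib, ← Finset.mul_sum, expectedMoves,
    expectedGain] at h3
  -- Sums over resources become sums over pairs of players, so that the estimate can be finished
  -- pair by pair.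
  simp only [sum_sum_imitationPairs_mul] at h3
  refine h3.trans ?_
  rcases isEmpty_or_nonempty (Fin G.numPlayers) with hn | ⟨⟨i₀⟩⟩
  · simp [virtualGain]
  have hW := inv_numPlayers_sub_one_nonneg i₀
  unfold virtualGain
  set W := ((G.numPlayers : ℝ) - 1)⁻¹
  have h4 := mul_le_mul_of_nonneg_left (Finset.sum_le_sum
    fun (p : Fin G.numPlayers × Fin G.numPlayers) (_ : p ∈ Finset.univ) =>
      virtualGain_term_le hlam hlam40 hd hν s p.1 (s p.2) (sum_slope_le hd hsl s p.1 (s p.2))) hW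
  simp only [Finset.sum_add_distrib, Finset.sum_sub_distrib, ← Finset.mul_sum] at h4
  unfold gainedLatency droppedLatency at h4
  linarith

theorem potential_nonneg (s : G.Profile) : 0 ≤ potential s :=
  Finset.sum_nonneg fun e _ => Finset.sum_nonneg fun u _ =>
    G.latency_nonneg e _ (Nat.cast_nonneg u)

/-- Each of the `x_e` summands on `e` is at most `ℓ_e(x_e)`, and `∑_e x_e ℓ_e(x_e)` is the total
latency of the players. -/
theorem potential_le_mul_maxLatency (s : G.Profile) :
    potential s ≤ G.numPlayers * G.maxLatency := by
  classical
  calc potential s ≤ ∑ e, (congestion s e : ℝ) * G.latency e (congestion s e) := by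
        refine Finset.sum_le_sum fun e _ => ?_
        refine (Finset.sum_le_card_nsmul _ _ (G.latency e (congestion s e)) fun u hu => ?_).trans ?_
        · exact G.latency_mono e (Set.mem_Ici.2 (Nat.cast_nonneg _))
            (Set.mem_Ici.2 (Nat.cast_nonneg _)) (Nat.cast_le.2 (Finset.mem_Icc.1 hu).2)
        · simp
    _ = ∑ i, strategyLatency s (s i) := by
        have h : ∀ i, strategyLatency s (s i) =
            ∑ e, if e ∈ (s i).1 then G.latency e (congestion s e) else 0 := by
          intro i
          rw [strategyLatency, ← Finset.sum_filter]
          refine Finset.sum_congr ?_ fun _ _ => rfl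
          ext e
          simp
        simp_rw [h]
        rw [Finset.sum_comm]
        refine Finset.sum_congr rfl fun e _ => ?_
        rw [← Finset.sum_filter, Finset.sum_const, nsmul_eq_mul, congestion_eq_card]
    _ ≤ ∑ _i : Fin G.numPlayers, G.maxLatency :=
        Finset.sum_le_sum fun i _ => strategyLatency_le_maxLatency s (s i)
    _ = G.numPlayers * G.maxLatency := by simp

/-- The bound on `T` is needed only for at least two players: otherwise the start is already stable
and the time is `0`. -/
theorem convergesInExpectedTime_of_le (hlam : 0 < lam) (hlam40 : lam ≤ 1 / 40) (hd : 1 ≤ d)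
    (hν : 0 < ν) (hel : G.IsElasticityBound d) (hsl : G.IsSlopeBound d ν) (s : G.Profile) {T : ℝ}
    (hT : 2 ≤ G.numPlayers →
      2 / lam * (d * G.numPlayers * G.maxLatency * potential s / ν ^ 2) ≤ T) :
    ConvergesInExpectedTime lam d ν s T := by
  refine convergesInExpectedTime_of_lintegral_le hlam (by linarith) hd hν.le ?_
  have hstable := isImitationStable_iff (G := G) hlam (by linarith) hd hν.le
  by_cases hs : HasImprovement ν s
  swap
  · have h0 : ∫⁻ w, stableTime lam d ν w ∂(imitationDynamics lam d ν s) = 0 := by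
      refine (lintegral_congr_ae ?_).trans lintegral_zero
      filter_upwards [ae_markovChainLaw_zero (G.roundKernel lam d ν) s] with w hw
      have h1 : stableTime lam d ν w ≤ ((0 : ℕ) : ℝ≥0∞) :=
        iInf₂_le 0 (by rw [hw]; exact (hstable s).2 hs)
      simpa using h1
    rw [h0]
    exact zero_le
  have hn := two_le_numPlayers hν.le hs
  obtain ⟨i, j, hij⟩ := hs
  have hn0 : (0 : ℝ) < G.numPlayers := by exact_mod_cast (by omega : 0 < G.numPlayers)
  have hmax : 0 < G.maxLatency := by
    linarith [latencyAfterMove_nonneg s i (s j), strategyLatency_le_maxLatency s (s i)]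
  set c := 1 / 2 * (lam * ν ^ 2 / (d * G.numPlayers * G.maxLatency)) with hc
  have hc0 : 0 < c := by
    have : 0 < d := by linarith
    positivity
  have hdrift : ∀ y ∉ {y : G.Profile | IsImitationStable lam d ν y},
      ∫⁻ z, ENNReal.ofReal (potential z) ∂(G.roundKernel lam d ν y) + ENNReal.ofReal c ≤
        ENNReal.ofReal (potential y) := by
    intro y hy
    have hy' : HasImprovement ν y := by
      by_contra hno
      exact hy ((hstable y).2 hno)
    rw [← ofReal_integral_eq_lintegral_ofReal (integrable_of_discrete _ _)
      (Filter.Eventually.of_forall potential_nonneg),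
      ← ENNReal.ofReal_add (integral_nonneg potential_nonneg) hc0.le]
    refine ENNReal.ofReal_le_ofReal ?_
    have h1 := integral_potential_le hlam.le hlam40 hd hν.le hel hsl y
    have h2 := le_virtualGain hlam.le hd hν.le hy'
    linarith
  have h := lintegral_hittingTime_le (G.roundKernel lam d ν) s
    (ENNReal.ofReal_pos.2 hc0).ne' ENNReal.ofReal_ne_top hdrift
  refine h.trans ?_
  rw [← ENNReal.ofReal_div_of_pos hc0]
  refine ENNReal.ofReal_le_ofReal (le_trans (le_of_eq ?_) (hT hn))
  rw [hc]
  have : 0 < d := by linarith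
  field_simp

end SymmetricCongestionGame

/-! ### Polynomial latencies. -/

section Polynomials

theorem Polynomial.eval_derivative_mul_le {p : Polynomial ℝ} (hp : ∀ i, 0 ≤ p.coeff i) {d : ℕ}
    (hd : p.natDegree ≤ d) {x : ℝ} (hx : 0 ≤ x) :
    p.derivative.eval x * x ≤ d * p.eval x := by
  rw [Polynomial.derivative_eval, Polynomial.eval_eq_sum, Polynomial.sum_def, Polynomial.sum_def,
    Finset.sum_mul, Finset.mul_sum]
  refine Finset.sum_le_sum fun i hi => ?_
  have hid : (i : ℝ) ≤ d := by
    exact_mod_cast (Polynomial.le_natDegree_of_mem_supp i hi).trans hd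
  have h0 : 0 ≤ p.coeff i * x ^ i := mul_nonneg (hp i) (pow_nonneg hx i)
  rcases i with _ | i
  · simp only [Nat.cast_zero, mul_zero, zero_mul]
    positivity
  · calc p.coeff (i + 1) * ((i + 1 : ℕ) : ℝ) * x ^ (i + 1 - 1) * x
        = ((i + 1 : ℕ) : ℝ) * (p.coeff (i + 1) * x ^ (i + 1)) := by
          rw [Nat.add_sub_cancel, pow_succ]; ring
      _ ≤ _ := mul_le_mul_of_nonneg_right hid h0

theorem Polynomial.leadingCoeff_le_eval_one_sub {p : Polynomial ℝ} (hp : ∀ i, 0 ≤ p.coeff i)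
    (hd : 0 < p.natDegree) : p.leadingCoeff ≤ p.eval 1 - p.eval 0 := by
  obtain ⟨m, hm⟩ := Nat.exists_eq_succ_of_ne_zero hd.ne'
  rw [← Polynomial.coeff_zero_eq_eval_zero, Polynomial.eval_eq_sum_range, Finset.sum_range_succ,
    Polynomial.leadingCoeff, hm, Finset.sum_range_succ']
  simp only [one_pow, mul_one]
  have := Finset.sum_nonneg (s := Finset.range m) fun i _ => hp (i + 1)
  linarith

theorem sum_range_succ_pow_le {n : ℝ} (hn : 2 ≤ n) (d : ℕ) :
    ∑ i ∈ Finset.range (d + 1), n ^ i ≤ 2 * n ^ d := by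
  induction d with
  | zero => simp
  | succ d ih =>
    rw [Finset.sum_range_succ, pow_succ]
    nlinarith [pow_pos (by linarith : 0 < n) d]

theorem Polynomial.eval_le_of_coeff_le {p : Polynomial ℝ} {a : ℝ} (ha : 0 ≤ a)
    (hp : ∀ i, p.coeff i ≤ a) {d : ℕ} (hd : p.natDegree ≤ d) {n : ℝ} (hn : 2 ≤ n) :
    p.eval n ≤ 2 * a * n ^ d := by
  rw [Polynomial.eval_eq_sum_range' (Nat.lt_succ_of_le hd)]
  calc ∑ i ∈ Finset.range (d + 1), p.coeff i * n ^ i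
      ≤ ∑ i ∈ Finset.range (d + 1), a * n ^ i :=
        Finset.sum_le_sum fun i _ => mul_le_mul_of_nonneg_right (hp i) (by positivity)
    _ = a * ∑ i ∈ Finset.range (d + 1), n ^ i := by rw [Finset.mul_sum]
    _ ≤ a * (2 * n ^ d) := mul_le_mul_of_nonneg_left (sum_range_succ_pow_le hn d) ha
    _ = _ := by ring

end Polynomials

namespace SymmetricCongestionGame

variable {E : Type*} {G : SymmetricCongestionGame E}

theorem maxLatency_le {b : ℝ} (hb : 0 ≤ b) (h : ∀ e, G.latency e G.numPlayers ≤ b) :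
    G.maxLatency ≤ (G.strategies.sup Finset.card : ℕ) * b := by
  refine Real.iSup_le (fun q => ?_) (by positivity)
  have hP : q.2.1.card ≤ G.strategies.sup Finset.card := Finset.le_sup (f := Finset.card) q.2.2
  calc strategyLatency q.1 q.2 ≤ q.2.1.card • b := Finset.sum_le_card_nsmul _ _ _ fun e _ =>
        (G.latency_mono e (Set.mem_Ici.2 (Nat.cast_nonneg _)) (Set.mem_Ici.2 (Nat.cast_nonneg _))
          (Nat.cast_le.2 (congestion_le q.1 e))).trans (h e)
    _ = q.2.1.card * b := nsmul_eq_mul _ _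
    _ ≤ _ := mul_le_mul_of_nonneg_right (by exact_mod_cast hP) hb

theorem isElasticityBound_of_polynomial {p : E → Polynomial ℝ} {d : ℕ}
    (hp : ∀ e x, 0 ≤ x → G.latency e x = (p e).eval x) (hd : ∀ e, (p e).natDegree ≤ d)
    (hcoeff : ∀ e i, 0 ≤ (p e).coeff i) : G.IsElasticityBound d := by
  intro e x hx
  have hev : G.latency e =ᶠ[nhds x] fun y => (p e).eval y := by
    filter_upwards [Ioi_mem_nhds hx.1] with y hy using hp e y (le_of_lt hy)
  rw [div_le_iff₀ (G.latency_pos e x hx.1), hev.deriv_eq, Polynomial.deriv, hp e x hx.1.le]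
  exact Polynomial.eval_derivative_mul_le (hcoeff e) (hd e) hx.1.le

/-- The step `u = 1` in the slope of a non-constant latency is `p(1) - p(0)`, the sum of the
non-constant coefficients. Hence `ν` is bounded below, and is positive when `aMin` is. -/
theorem le_of_isSlopeBound_of_polynomial {p : E → Polynomial ℝ} {d : ℕ} {aMin ν : ℝ}
    (hp : ∀ e x, 0 ≤ x → G.latency e x = (p e).eval x) (hd : ∀ e, (p e).natDegree ≤ d)
    (hcoeff : ∀ e i, 0 ≤ (p e).coeff i) (hsl : G.IsSlopeBound d ν) {P : Finset E}
    (hP : P ∈ G.strategies) {e : E} (he : e ∈ P) (hdeg : 0 < (p e).natDegree)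
    (hlead : aMin ≤ (p e).leadingCoeff) : aMin ≤ ν := by
  have hd1 : 1 ≤ d := hdeg.trans_le (hd e)
  have hd1' : (1 : ℝ) ≤ d := by exact_mod_cast hd1
  have h1 := sub_le_slope (G := G) (d : ℝ) e le_rfl (by simpa using hd1)
  rw [Nat.cast_one, sub_self, hp e 1 zero_le_one, hp e 0 le_rfl] at h1
  exact hlead.trans ((Polynomial.leadingCoeff_le_eval_one_sub (hcoeff e) hdeg).trans (h1.trans
    ((Finset.single_le_sum (f := G.slope d) (fun e' _ => slope_nonneg hd1' e') he).trans
      (hsl P hP))))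

end SymmetricCongestionGame

/-! ### The main theorem. -/

theorem mainTheorem2 :
    ∃ lam₀ : ℝ, 0 < lam₀ ∧ ∀ lam : ℝ, 0 < lam → lam ≤ lam₀ → ∃ C : ℝ, 0 < C ∧
      (∀ (E : Type*) [Fintype E] (G : SymmetricCongestionGame E) (d ν : ℝ),
        1 ≤ d → G.IsElasticityBound d → 0 < ν → G.IsSlopeBound d ν →
        ∀ s : G.Profile, SymmetricCongestionGame.ConvergesInExpectedTime lam d ν s
          (C * (d * G.numPlayers * G.maxLatency * SymmetricCongestionGame.potential s / ν ^ 2))) ∧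
      (∀ (E : Type*) [Fintype E] (G : SymmetricCongestionGame E) (p : E → Polynomial ℝ) (d : ℕ)
        (aMin aMax ν : ℝ),
        (∀ e x, 0 ≤ x → G.latency e x = (p e).eval x) →
        (∀ e, (p e).natDegree ≤ d) →
        (∃ P ∈ G.strategies, ∃ e ∈ P, 0 < (p e).natDegree) →
        0 < aMin →
        (∀ e i, (p e).coeff i ≠ 0 → aMin ≤ (p e).coeff i ∧ (p e).coeff i ≤ aMax) →
        G.IsSlopeBound d ν →
        ∀ s : G.Profile, SymmetricCongestionGame.ConvergesInExpectedTime lam d ν s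
          (C * ((d : ℝ) ^ 2 * ((G.strategies.sup Finset.card : ℕ) : ℝ) ^ 2
            * (G.numPlayers : ℝ) ^ (2 * d + 2) * (aMax / aMin) ^ 2))) := by
  -- Part 1 needs only `2 / lam`; the further factor `4` is the square of the `2` in the bound `2 *
  -- aMax * n ^ d` on a single latency.
  refine ⟨1 / 40, by norm_num, fun lam hlam hlam40 => ⟨8 / lam, by positivity, ?_, ?_⟩⟩
  · intro E _ G d ν hd hel hν hsl s
    refine SymmetricCongestionGame.convergesInExpectedTime_of_le hlam hlam40 hd hν hel hsl s
      fun _ => ?_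
    have h1 := SymmetricCongestionGame.potential_nonneg s
    have h2 := SymmetricCongestionGame.maxLatency_nonneg (G := G)
    have h3 : 0 ≤ d := by linarith
    refine mul_le_mul_of_nonneg_right ?_ (by positivity)
    gcongr
    norm_num
  · intro E _ G p d aMin aMax ν hp hdeg ⟨P, hP, e, heP, he⟩ hmin hcoeff hsl s
    have hlead : (p e).coeff (p e).natDegree ≠ 0 := by
      rw [Polynomial.coeff_natDegree, Polynomial.leadingCoeff_ne_zero]
      rintro h
      simp [h] at he
    have hmax : 0 < aMax := hmin.trans_le ((hcoeff e _ hlead).1.trans (hcoeff e _ hlead).2)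
    have hc0 : ∀ e i, 0 ≤ (p e).coeff i := by
      intro e i
      by_cases h : (p e).coeff i = 0
      · exact h.ge
      · exact hmin.le.trans (hcoeff e i h).1
    have hc1 : ∀ e i, (p e).coeff i ≤ aMax := by
      intro e i
      by_cases h : (p e).coeff i = 0
      · exact h.le.trans hmax.le
      · exact (hcoeff e i h).2
    have hd1 : (1 : ℝ) ≤ d := by exact_mod_cast he.trans_le (hdeg e)
    have hν : aMin ≤ ν := SymmetricCongestionGame.le_of_isSlopeBound_of_polynomial hp hdeg hc0 hsl
      hP heP he (hcoeff e _ hlead).1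
    refine SymmetricCongestionGame.convergesInExpectedTime_of_le hlam hlam40 hd1
      (hmin.trans_le hν) (SymmetricCongestionGame.isElasticityBound_of_polynomial hp hdeg hc0)
      hsl s fun hn => ?_
    have hn2 : (2 : ℝ) ≤ G.numPlayers := by exact_mod_cast hn
    have hL : G.maxLatency ≤ (G.strategies.sup Finset.card : ℕ) *
        (2 * aMax * (G.numPlayers : ℝ) ^ d) :=
      SymmetricCongestionGame.maxLatency_le (by positivity) fun e => by
        rw [hp e _ (Nat.cast_nonneg _)]
        exact Polynomial.eval_le_of_coeff_le hmax.le (hc1 e) (hdeg e) hn2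
    have hΦ := SymmetricCongestionGame.potential_le_mul_maxLatency s
    have hΦ0 := SymmetricCongestionGame.potential_nonneg s
    have hL0 := SymmetricCongestionGame.maxLatency_nonneg (G := G)
    set k : ℝ := ((G.strategies.sup Finset.card : ℕ) : ℝ)
    set n : ℝ := (G.numPlayers : ℝ)
    calc 2 / lam * (d * n * G.maxLatency * SymmetricCongestionGame.potential s / ν ^ 2)
        ≤ 2 / lam * (d * n * G.maxLatency * (n * G.maxLatency) / aMin ^ 2) := by gcongr
      _ = 2 / lam * (d * n ^ 2 * G.maxLatency ^ 2 / aMin ^ 2) := by ring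
      _ ≤ 2 / lam * (d * n ^ 2 * (k * (2 * aMax * n ^ d)) ^ 2 / aMin ^ 2) := by gcongr
      _ = 8 / lam * (d * k ^ 2 * n ^ (2 * d + 2) * (aMax / aMin) ^ 2) := by
          rw [div_pow, pow_add, mul_comm 2 d, pow_mul]; ring
      _ ≤ 8 / lam * ((d : ℝ) ^ 2 * k ^ 2 * n ^ (2 * d + 2) * (aMax / aMin) ^ 2) := by
          have : (d : ℝ) ≤ (d : ℝ) ^ 2 := le_self_pow₀ hd1 two_ne_zero
          gcongr
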